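/- **Setting.** Let $T>0$, $x_0\in\mathbb R^n$, $a_0\in\mathbb R^{mn}$, $b_0\in\mathbb R^m$, $U\subset\mathbb R^d$, $g:\mathbb R^n\times\mathbb R^d\to\mathbb R^n$, $\varphi:\mathbb R^n\to(-\infty,\infty]$ and $\ell:[0,T]\times\mathbb R^{n+mn+m}\times\mathbb R^d\times\mathbb R^{n+mn+m}\to(-\infty,\infty]$. For $a=(a_1,\dots,a_m)\in\mathbb R^{mn}$, $b\in\mathbb R^m$ put $C(a,b)=\{x\in\mathbb R^n:\langle a_i,x\rangle\le b_i,\ i=1,\dots,m\}$ and $F(x,a,b,u)=N(x;C(a,b))-g(x,u)$, where $N(x;C)=\{v:\langle v,y-x\rangle\le0\ \forall y\in C\}$ if $x\in C$ and $N(x;C)=\emptyset$ otherwise. The sweeping control problem $(P)$ is to minimize $$J[x,a,b,u]=\varphi(x(T))+\int_0^T\ell\big(t,x(t),a(t),b(t),u(t),\dot x(t),\dot a(t),\dot b(t)\big)\,dt$$ over the feasible solutions, i.e. the quadruples $(x,a,b,u)$ with $x,a,b\in W^{1,2}$, $u\in L^2$ on $[0,T]$, such that $(x,a,b)(0)=(x_0,a_0,b_0)$,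 $-\dot x(t)\in F(x(t),a(t),b(t),u(t))$ and $u(t)\in U$ for a.e. $t$, $\|a_i(t)\|=1$ and $x(t)\in C(a(t),b(t))$ for all $t\in[0,T]$ and all $i$, and the running cost is integrable. The relaxed problem $(R)$ is to minimize $\widehat J[x,a,b,u]=\varphi(x(T))+\int_0^T\widehat\ell_F(t,x,a,b,u,\dot x,\dot a,\dot b)\,dt$ over all $(x,a,b,u)$ in the same spaces with the same initial values, $\|a_i(t)\|=1$ on $[0,T]$, and finite running cost, where $\ell_F$ equals $\ell$ if $u\in U$ and $-\dot x\in F(x,a,b,u)$ and equals $+\infty$ otherwise, and $\widehat\ell_F(t,x,a,b,\cdot)$ is the largest l.s.c. convex function of $(u,\dot x,\dot a,\dot b)$ majorized by $\ell_F(t,x,a,b,\cdot)$. A quadruple $\bar z=(\bar x,\bar a,\bar b,\bar u)$ is a relaxed intermediate local minimizer (r.i.l.m.) of $(P)$ with radius $\bar\varepsilon>0$ if it is feasible for $(P)$ and for $(R)$, and $J[\bar z]=\widehat J[\bar z]\le\widehat J[x,a,b,u]$ for all $(x,a,b,u)$ feasible for $(R)$ with $\|x-\bar x\|_{W^{1,2}}+\|(a,b)-(\bar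 a,\bar b)\|_{W^{1,2}}+\|u-\bar u\|_{L^2}\le\bar\varepsilon$. **Assumptions.** Let $\bar z$ be an r.i.l.m. with radius $\bar\varepsilon$ such that: * $U$ is compact, and $\dot{\bar a}_i,\dot{\bar b}_i$ are essentially bounded; * $\|g(x_1,u_1)-g(x_2,u_2)\|\le L(\|x_1-x_2\|+\|u_1-u_2\|)$ and $\|g(x,u)\|\le M(1+\|x\|)$ for all $x,x_1,x_2\in\mathbb R^n$, $u,u_1,u_2\in U$, with some $L,M>0$; * there are $v_i\in W^{1,2}([0,T];\mathbb R)$ with $\|\bar a_i(t)-\bar a_i(s)\|\le|v_i(t)-v_i(s)|$ for all $s,t,i$, and a continuous $\vartheta:[0,T]\to\mathbb R$ with $\sup\vartheta<0$ such that for every $t\in[0,T]$ some $x\in\mathbb R^n$ satisfies $\langle\bar a_i(t),x\rangle-\bar b_i(t)<\vartheta(t)$ for all $i$; * $\varphi$ is l.s.c., and there are $\rho>0$ and $c\in\mathbb R$ such that almost every $t\in[0,T]$ is *regular*, meaning that $\ell(t,\cdot)$ is l.s.c. and $\ge c$ on the set of all $(x,a,b,u,\dot x,\dot a,\dot b)$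 with $(x,a,b)$ at distance less than $\rho$ from $(\bar x,\bar a,\bar b)(t)$ (the distance being the largest of the Euclidean distances of the three components), $u\in U$, and arbitrary $(\dot x,\dot a,\dot b)$; * $\dot{\bar x},\dot{\bar a},\dot{\bar b},\bar u$ have (fixed, everywhere defined) representatives of bounded variation on $[0,T]$, and $\bar u(0)\in U$. **Discrete problems.** Let $\Delta_k=\{0=t^k_0<\dots<t^k_{\nu(k)}=T\}$ be partitions with $\nu(k)\ge k$ and $h^k_j:=t^k_{j+1}-t^k_j\le\tilde\nu/\nu(k)$ for a constant $\tilde\nu>0$, whose nodes $t^k_0,\dots,t^k_{\nu(k)-1}$ are regular, and let $\delta_k>0$, $\delta_k\to0$. For $\varepsilon>0$ the problem $(P_k)$ is to minimize, over $x_0,\dots,x_{\nu(k)}$, $a_0,\dots,a_{\nu(k)}$, $b_0,\dots,b_{\nu(k)}$, $u_0,\dots,u_{\nu(k)-1}$, with $h_j=h_j^k$, $t_j=t_j^k$ and $(\dot x_j,\dot a_j,\dot b_j):=\big((x_{j+1},a_{j+1},b_{j+1})-(x_j,a_j,b_j)\big)/h_j$, the cost $$\varphi(x_{\nu(k)})+\sum_{j=0}^{\nu(k)-1}h_j\,\ell(t_j,x_j,a_j,b_j,u_j,\dot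 x_j,\dot a_j,\dot b_j)+\frac12\sum_{j=0}^{\nu(k)-1}\int_{t_j}^{t_{j+1}}\big\|(\dot x_j,\dot a_j,\dot b_j,u_j)-(\dot{\bar x},\dot{\bar a},\dot{\bar b},\bar u)(t)\big\|^2dt$$ subject to $x_{j+1}\in x_j-h_jF(x_j,a_j,b_j,u_j)$ and $u_j\in U$ for $j<\nu(k)$; $x_{\nu(k)}\in C(a_{\nu(k)},b_{\nu(k)})$; given initial values $x_0\in C(a_0,b_0)$, $a_0$, $b_0$ and $u_0=\bar u(0)$; $1-\delta_k\le\|a_{ij}\|\le1+\delta_k$ for the components $a_{ij}\in\mathbb R^n$, $i=1,\dots,m$, of $a_j$, $j=0,\dots,\nu(k)$; and $$\sum_{j}\int_{t_j}^{t_{j+1}}\big\|(x_j,a_j,b_j,u_j)-(\bar x,\bar a,\bar b,\bar u)(t)\big\|^2dt\le\frac\varepsilon2,\qquad\sum_{j}\int_{t_j}^{t_{j+1}}\big\|(\dot x_j,\dot a_j,\dot b_j)-(\dot{\bar x},\dot{\bar a},\dot{\bar b})(t)\big\|^2dt\le\frac\varepsilon2 .$$ **Proposition.** There is $\varepsilon_0\in(0,\bar\varepsilon]$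 such that for every $\varepsilon\in(0,\varepsilon_0]$ and all sequences $(\Delta_k)$, $(\delta_k)$ as above, the problem $(P_k)$ has an optimal solution (a feasible point at which the cost, with values in $(-\infty,\infty]$, is least among all feasible points) for all sufficiently large $k$. -/

import Mathlib

open MeasureTheory Set Filter Topology

noncomputable section

namespace SweepingControl

/-- `ℝⁿ` with the Euclidean norm. -/
abbrev E (n : ℕ) : Type := EuclideanSpace ℝ (Fin n)

/-- `ℝᵐⁿ`, as `m`-tuples of vectors of `ℝⁿ`, with the Euclidean norm. -/
abbrev A (n m : ℕ) : Type := PiLp 2 (fun _ : Fin m => E n)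

/-- The space of the variables `(x, a, b)`, and of their velocities. -/
abbrev XAB (n m : ℕ) : Type := E n × A n m × E m

/-- The square of the Euclidean norm of `(x, a, b)`. -/
def sqNorm {n m : ℕ} (q : XAB n m) : ℝ := ‖q.1‖ ^ 2 + ‖q.2.1‖ ^ 2 + ‖q.2.2‖ ^ 2

/-- The convex polyhedron `C(a, b) = {x | ⟨aᵢ, x⟩ ≤ bᵢ for all i}`. -/
def polyhedron {n m : ℕ} (a : A n m) (b : E m) : Set (E n) :=
  {x | ∀ i, inner ℝ (a i) x ≤ b i}

/-- The normal cone of convex analysis; it is empty at points outside the set. -/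
def normalCone {n : ℕ} (x : E n) (C : Set (E n)) : Set (E n) :=
  {v | x ∈ C ∧ ∀ y ∈ C, inner ℝ v (y - x) ≤ 0}

/-- A function of class `W^{1,2}([0,T]; V)`: it is the integral of the square integrable
function `vel`, a representative of its weak derivative. -/
structure W12 (T : ℝ) (V : Type) [NormedAddCommGroup V] [NormedSpace ℝ V] where
  toFun : ℝ → V
  vel : ℝ → V
  memLp_vel : MemLp vel 2 (volume.restrict (Icc 0 T))
  eq_integral : ∀ t ∈ Icc 0 T, toFun t = toFun 0 + ∫ s in (0 : ℝ)..t, vel s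

/-- The data of the sweeping optimal control problem. The costs take values in `(-∞, ∞]`. -/
structure Data (n m d : ℕ) where
  T : ℝ
  T_pos : 0 < T
  U : Set (E d)
  g : E n → E d → E n
  /-- terminal cost -/
  φ : E n → EReal
  φ_ne_bot : ∀ x, φ x ≠ ⊥
  /-- running cost, with arguments `t` and `((x, a, b), u, (ẋ, ȧ, ḃ))` -/
  ℓ : ℝ → XAB n m × E d × XAB n m → EReal
  ℓ_ne_bot : ∀ t p, ℓ t p ≠ ⊥
  x₀ : E n
  a₀ : A n m
  b₀ : E m

variable {n m d : ℕ}

/-- The velocity mapping `F(x, a, b, u) = N(x; C(a, b)) - g(x, u)`. -/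
def Data.F (P : Data n m d) (q : XAB n m) (u : E d) : Set (E n) :=
  {v | ∃ w ∈ normalCone q.1 (polyhedron q.2.1 q.2.2), v = w - P.g q.1 u}

/-- Quadruples `(x, a, b, u)` in `W^{1,2} × W^{1,2} × W^{1,2} × L²`. -/
structure Quad (P : Data n m d) where
  x : W12 P.T (E n)
  a : W12 P.T (A n m)
  b : W12 P.T (E m)
  u : ℝ → E d
  memLp_u : MemLp u 2 (volume.restrict (Icc 0 P.T))

/-- `(x(t), a(t), b(t))`. -/
def Quad.pos {P : Data n m d} (z : Quad P) (t : ℝ) : XAB n m :=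
  (z.x.toFun t, z.a.toFun t, z.b.toFun t)

/-- `(ẋ(t), ȧ(t), ḃ(t))`. -/
def Quad.vel {P : Data n m d} (z : Quad P) (t : ℝ) : XAB n m :=
  (z.x.vel t, z.a.vel t, z.b.vel t)

/-- The extended-real function `L` has a well-defined finite integral over `[0, T]`. -/
def FiniteIntegral (T : ℝ) (L : ℝ → EReal) : Prop :=
  (∀ᵐ t ∂(volume.restrict (Icc 0 T)), L t ≠ ⊤ ∧ L t ≠ ⊥) ∧
    Integrable (fun t => (L t).toReal) (volume.restrict (Icc 0 T))

/-- The running cost along `z`. -/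
def Quad.run {P : Data n m d} (z : Quad P) (t : ℝ) : EReal :=
  P.ℓ t (z.pos t, z.u t, z.vel t)

/-- The Bolza functional `J`. -/
def Quad.J {P : Data n m d} (z : Quad P) : EReal :=
  P.φ (z.x.toFun P.T) + ((∫ t in Icc 0 P.T, (z.run t).toReal : ℝ) : EReal)

/-- The initial conditions. -/
def Quad.Initial {P : Data n m d} (z : Quad P) : Prop :=
  z.x.toFun 0 = P.x₀ ∧ z.a.toFun 0 = P.a₀ ∧ z.b.toFun 0 = P.b₀

/-- The constraints `‖aᵢ(t)‖ = 1` on `[0, T]`. -/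
def Quad.UnitNormals {P : Data n m d} (z : Quad P) : Prop :=
  ∀ t ∈ Icc 0 P.T, ∀ i, ‖z.a.toFun t i‖ = 1

/-- Feasible solutions of the sweeping control problem `(P)`. -/
structure Quad.Feasible {P : Data n m d} (z : Quad P) : Prop where
  initial : z.Initial
  control : ∀ᵐ t ∂(volume.restrict (Icc 0 P.T)), z.u t ∈ P.U
  inclusion : ∀ᵐ t ∂(volume.restrict (Icc 0 P.T)), -(z.x.vel t) ∈ P.F (z.pos t) (z.u t)
  unit : z.UnitNormals
  mixed : ∀ t ∈ Icc 0 P.T, z.x.toFun t ∈ polyhedron (z.a.toFun t) (z.b.toFun t)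
  cost : FiniteIntegral P.T z.run

/-- The largest lower semicontinuous convex function majorized by `f` (the pointwise supremum
of all such functions; convexity of an extended-real function is convexity of its epigraph). -/
def lscConvexHull {V : Type} [TopologicalSpace V] [AddCommGroup V] [Module ℝ V]
    (f : V → EReal) (z : V) : EReal :=
  sSup {r | ∃ h : V → EReal, LowerSemicontinuous h ∧
    Convex ℝ {p : V × ℝ | h p.1 ≤ (p.2 : EReal)} ∧ (∀ y, h y ≤ f y) ∧ r = h z}

open Classical in
/-- The running cost restricted to the controls `u ∈ U` and velocities `-ẋ ∈ F(x, a, b, u)`,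
extended by `+∞`, as a function of `(u, ẋ, ȧ, ḃ)`. -/
def Data.ℓF (P : Data n m d) (t : ℝ) (q : XAB n m) (p : E d × XAB n m) : EReal :=
  if p.1 ∈ P.U ∧ -p.2.1 ∈ P.F q p.1 then P.ℓ t (q, p.1, p.2) else ⊤

/-- The relaxed running cost along `z`: convexification in `(u, ẋ, ȧ, ḃ)`. -/
def Quad.relaxedRun {P : Data n m d} (z : Quad P) (t : ℝ) : EReal :=
  lscConvexHull (P.ℓF t (z.pos t)) (z.u t, z.vel t)

/-- The relaxed cost functional. -/
def Quad.relaxedJ {P : Data n m d} (z : Quad P) : EReal :=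
  P.φ (z.x.toFun P.T) + ((∫ t in Icc 0 P.T, (z.relaxedRun t).toReal : ℝ) : EReal)

/-- Feasible solutions of the relaxed problem `(R)`. -/
structure Quad.RelaxedFeasible {P : Data n m d} (z : Quad P) : Prop where
  initial : z.Initial
  unit : z.UnitNormals
  cost : FiniteIntegral P.T z.relaxedRun

/-- `‖x - x'‖_{W^{1,2}} + ‖(a, b) - (a', b')‖_{W^{1,2}} + ‖u - u'‖_{L²}`. -/
def Quad.dist {P : Data n m d} (z w : Quad P) : ℝ :=
  Real.sqrt (∫ t in Icc 0 P.T,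
      (‖z.x.toFun t - w.x.toFun t‖ ^ 2 + ‖z.x.vel t - w.x.vel t‖ ^ 2)) +
    Real.sqrt (∫ t in Icc 0 P.T,
      (‖z.a.toFun t - w.a.toFun t‖ ^ 2 + ‖z.b.toFun t - w.b.toFun t‖ ^ 2 +
        ‖z.a.vel t - w.a.vel t‖ ^ 2 + ‖z.b.vel t - w.b.vel t‖ ^ 2)) +
    Real.sqrt (∫ t in Icc 0 P.T, ‖z.u t - w.u t‖ ^ 2)

/-- `z` is a relaxed intermediate local minimizer of `(P)` with radius `ε`. -/
structure Quad.IsRILM {P : Data n m d} (z : Quad P) (ε : ℝ) : Prop where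
  pos : 0 < ε
  feasible : z.Feasible
  relaxedFeasible : z.RelaxedFeasible
  J_eq : z.J = z.relaxedJ
  le : ∀ w : Quad P, w.RelaxedFeasible → w.dist z ≤ ε → z.relaxedJ ≤ w.relaxedJ

/-- The control set is compact. -/
def CompactControls (P : Data n m d) : Prop := IsClosed P.U ∧ Bornology.IsBounded P.U

/-- The derivatives of the moving set controls are essentially bounded. -/
def BoundedDerivatives {P : Data n m d} (z : Quad P) : Prop :=
  ∃ M : ℝ, ∀ᵐ t ∂(volume.restrict (Icc 0 P.T)), ∀ i, ‖z.a.vel t i‖ ≤ M ∧ |z.b.vel t i| ≤ M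

/-- Lipschitz continuity and sublinear growth of the perturbation. -/
def PerturbationRegular (P : Data n m d) : Prop :=
  (∃ L : ℝ, 0 < L ∧ ∀ x₁ x₂, ∀ u₁ ∈ P.U, ∀ u₂ ∈ P.U,
      ‖P.g x₁ u₁ - P.g x₂ u₂‖ ≤ L * (‖x₁ - x₂‖ + ‖u₁ - u₂‖)) ∧
    ∃ M : ℝ, 0 < M ∧ ∀ x, ∀ u ∈ P.U, ‖P.g x u‖ ≤ M * (1 + ‖x‖)

/-- Regularity of the moving normals and the uniform Slater condition. -/
def UniformSlater {P : Data n m d} (z : Quad P) : Prop :=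
  (∃ v : Fin m → W12 P.T ℝ, ∀ i, ∀ s ∈ Icc 0 P.T, ∀ t ∈ Icc 0 P.T,
      ‖z.a.toFun t i - z.a.toFun s i‖ ≤ |(v i).toFun t - (v i).toFun s|) ∧
    ∃ θ : ℝ → ℝ, ContinuousOn θ (Icc 0 P.T) ∧ sSup (θ '' Icc 0 P.T) < 0 ∧
      ∀ t ∈ Icc 0 P.T, ∃ x : E n, ∀ i, inner ℝ (z.a.toFun t i) x - z.b.toFun t i < θ t

/-- The points `((x, a, b), u, (ẋ, ȧ, ḃ))` with `(x, a, b)` at distance less than `ρ` from the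
position of `z` at time `t`, with control in `U` and with arbitrary velocities. -/
def tube {P : Data n m d} (z : Quad P) (ρ t : ℝ) : Set (XAB n m × E d × XAB n m) :=
  {p | dist p.1 (z.pos t) < ρ ∧ p.2.1 ∈ P.U}

/-- At time `t`, the running cost is lower semicontinuous and bounded below by `c`
around `z`. -/
def RunningCostRegularAt {P : Data n m d} (z : Quad P) (ρ c t : ℝ) : Prop :=
  LowerSemicontinuousOn (P.ℓ t) (tube z ρ t) ∧ ∀ p ∈ tube z ρ t, (c : EReal) ≤ P.ℓ t p

/-- Lower semicontinuity of the terminal cost; lower semicontinuity and boundedness from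
below of the running cost around `z`, for almost every time. -/
def CostRegular {P : Data n m d} (z : Quad P) (ρ c : ℝ) : Prop :=
  LowerSemicontinuous P.φ ∧
    ∀ᵐ t ∂(volume.restrict (Icc 0 P.T)), RunningCostRegularAt z ρ c t

/-- `ẋ`, `ȧ`, `ḃ` and `u` have bounded variation on `[0, T]`. -/
def BVQuad {P : Data n m d} (z : Quad P) : Prop :=
  BoundedVariationOn z.x.vel (Icc 0 P.T) ∧ BoundedVariationOn z.a.vel (Icc 0 P.T) ∧
    BoundedVariationOn z.b.vel (Icc 0 P.T) ∧ BoundedVariationOn z.u (Icc 0 P.T)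

/-- A partition `0 = t₀ < t₁ < ⋯ < t_ν = T`. -/
structure Mesh (T : ℝ) where
  ν : ℕ
  t : Fin (ν + 1) → ℝ
  strictMono : StrictMono t
  t_zero : t 0 = 0
  t_last : t (Fin.last ν) = T

/-- The step sizes `hⱼ = tⱼ₊₁ - tⱼ`. -/
def Mesh.h {T : ℝ} (Δ : Mesh T) (j : Fin Δ.ν) : ℝ := Δ.t j.succ - Δ.t j.castSucc

/-- Discrete quadruples `(x₀, …, x_ν, a₀, …, a_ν, b₀, …, b_ν, u₀, …, u_{ν-1})`. -/
structure DiscreteQuad (n m d ν : ℕ) where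
  x : Fin (ν + 1) → E n
  a : Fin (ν + 1) → A n m
  b : Fin (ν + 1) → E m
  u : Fin ν → E d

/-- `(xⱼ, aⱼ, bⱼ)`. -/
def DiscreteQuad.pos {ν : ℕ} (w : DiscreteQuad n m d ν) (j : Fin (ν + 1)) : XAB n m :=
  (w.x j, w.a j, w.b j)

/-- The difference quotients of `(x, a, b)` over the step `j`. -/
def DiscreteQuad.vel {T : ℝ} (Δ : Mesh T) (w : DiscreteQuad n m d Δ.ν) (j : Fin Δ.ν) :
    XAB n m :=
  (Δ.h j)⁻¹ • (w.pos j.succ - w.pos j.castSucc)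

/-- The cost of the discrete problem. -/
def discreteJ {P : Data n m d} (z : Quad P) (Δ : Mesh P.T) (w : DiscreteQuad n m d Δ.ν) :
    EReal :=
  P.φ (w.x (Fin.last Δ.ν)) +
    ∑ j : Fin Δ.ν, (Δ.h j : EReal) *
      P.ℓ (Δ.t j.castSucc) (w.pos j.castSucc, w.u j, w.vel Δ j) +
    (((1 / 2 : ℝ) * ∑ j : Fin Δ.ν, ∫ t in (Δ.t j.castSucc)..(Δ.t j.succ),
      (sqNorm (w.vel Δ j - z.vel t) + ‖w.u j - z.u t‖ ^ 2) : ℝ) : EReal)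

/-- The constraints of the discrete problem. -/
structure DiscreteFeasible {P : Data n m d} (z : Quad P) (ε δ : ℝ) (Δ : Mesh P.T)
    (w : DiscreteQuad n m d Δ.ν) : Prop where
  dynamics : ∀ j : Fin Δ.ν, ∃ v ∈ P.F (w.pos j.castSucc) (w.u j),
    w.x j.succ = w.x j.castSucc - Δ.h j • v
  terminal : w.x (Fin.last Δ.ν) ∈ polyhedron (w.a (Fin.last Δ.ν)) (w.b (Fin.last Δ.ν))
  initial_x : w.x 0 = P.x₀
  initial_mem : P.x₀ ∈ polyhedron P.a₀ P.b₀
  initial_a : w.a 0 = P.a₀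
  initial_b : w.b 0 = P.b₀
  initial_u : ∀ j : Fin Δ.ν, (j : ℕ) = 0 → w.u j = z.u 0
  close : ∑ j : Fin Δ.ν, ∫ t in (Δ.t j.castSucc)..(Δ.t j.succ),
    (sqNorm (w.pos j.castSucc - z.pos t) + ‖w.u j - z.u t‖ ^ 2) ≤ ε / 2
  close_vel : ∑ j : Fin Δ.ν, ∫ t in (Δ.t j.castSucc)..(Δ.t j.succ),
    sqNorm (w.vel Δ j - z.vel t) ≤ ε / 2
  control : ∀ j, w.u j ∈ P.U
  norm_a : ∀ j i, 1 - δ ≤ ‖w.a j i‖ ∧ ‖w.a j i‖ ≤ 1 + δ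

/-- Optimal solutions of the discrete problem. -/
def DiscreteOptimal {P : Data n m d} (z : Quad P) (ε δ : ℝ) (Δ : Mesh P.T)
    (w : DiscreteQuad n m d Δ.ν) : Prop :=
  DiscreteFeasible z ε δ Δ w ∧
    ∀ w', DiscreteFeasible z ε δ Δ w' → discreteJ z Δ w ≤ discreteJ z Δ w'

end SweepingControl

end

open SweepingControl

open SweepingControl

namespace SweepingControl

variable {n m d : ℕ}

/-! ### Finite sequences -/

/-! This is the Weierstrass theorem in a finite-dimensional space: for small `ε` the feasible set is
compact and the cost lower semicontinuous on it, and for fine meshes the set is nonempty.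

Localization comes first. The velocity constraint and the fixed initial values keep every feasible
point within `r` of the reference trajectory at all nodes once `ε ≤ r ^ 2 / T`
(`Quad.Initial.near`). With `r` small, the pairs `(a_j, b_j)` satisfy the Slater condition and the
points stay in the tube where the running cost is lower semicontinuous. Slater's condition makes the
graph of the normal cone closed (`normalCone_mem_of_tendsto`), which closes the discrete dynamics
under limits. This yields `isCompact_discreteFeasible` and `lowerSemicontinuousOn_discreteJ`.

Nonemptiness is the constructive part (`exists_discrete_approximation`). At each node an admissible
control and a normal are obtained as limits from the right (`exists_control_velocity`), and `x`
follows an explicit Euler scheme using these normals. The scheme leaves the reference trajectory,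
where the normals live, so the polyhedron is translated along with it: `a_j` remains the reference
value, hence of unit norm, and only `b_j` is corrected. Bounded variation controls the error: a jump
may make it large on a step, but the jumps have finite sum and each step is short, so the integrated
squared errors are of the order of the mesh size (`sum_integral_le`). -/

lemma sum_succ_sub_castSucc {V : Type*} [AddCommGroup V] {ν : ℕ} (f : Fin (ν + 1) → V) :
    ∑ j : Fin ν, (f j.succ - f j.castSucc) = f (Fin.last ν) - f 0 := by
  induction ν with
  | zero => simp [Fin.last]
  | succ ν ih =>
    rw [Fin.sum_univ_castSucc]
    have h := ih (fun i => f i.castSucc)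
    simp only [Fin.castSucc_zero] at h
    simp only [Fin.succ_castSucc, h, Fin.succ_last]
    abel

/-- A discrete Gronwall inequality. -/
lemma discrete_gronwall {ν : ℕ} (r : Fin (ν + 1) → ℝ) (h c : Fin ν → ℝ) (L : ℝ) (hL : 0 ≤ L)
    (hh : ∀ j, 0 ≤ h j) (hc : ∀ j, 0 ≤ c j) (h0 : r 0 ≤ 0) (hr : ∀ j, 0 ≤ r j)
    (hstep : ∀ j : Fin ν, r j.succ ≤ (1 + L * h j) * r j.castSucc + c j) (j : Fin (ν + 1)) :
    r j ≤ Real.exp (L * ∑ i, h i) * ∑ i, c i := by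
  induction ν with
  | zero =>
    obtain rfl : j = 0 := Fin.fin_one_eq_zero j
    simpa using h0
  | succ ν ih =>
    have key : ∀ i : Fin (ν + 1), r i.castSucc ≤
        Real.exp (L * ∑ i : Fin ν, h i.castSucc) * ∑ i : Fin ν, c i.castSucc := fun i =>
      ih (fun i => r i.castSucc) (fun i => h i.castSucc) (fun i => c i.castSucc)
        (fun j => hh _) (fun j => hc _) (by simpa using h0) (fun j => hr _)
        (fun j => by simpa using hstep j.castSucc) i
    have hS : 0 ≤ ∑ i : Fin ν, c i.castSucc := Finset.sum_nonneg fun i _ => hc _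
    have hH : 0 ≤ ∑ i : Fin ν, h i.castSucc := Finset.sum_nonneg fun i _ => hh _
    rw [Fin.sum_univ_castSucc, Fin.sum_univ_castSucc, mul_add L, Real.exp_add]
    set e := Real.exp (L * ∑ i : Fin ν, h i.castSucc) with he
    set S := ∑ i : Fin ν, c i.castSucc
    have hl : 0 ≤ L * h (Fin.last ν) := mul_nonneg hL (hh _)
    have he1 : 1 ≤ e := Real.one_le_exp (mul_nonneg hL hH)
    -- This inequality turns the product of the one-step factors into the exponential of a sum.
    have hel : 1 + L * h (Fin.last ν) ≤ Real.exp (L * h (Fin.last ν)) := by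
      linarith [Real.add_one_le_exp (L * h (Fin.last ν))]
    have hc' := hc (Fin.last ν)
    set q := Real.exp (L * h (Fin.last ν))
    have hq : 1 ≤ q := by linarith
    have heq : 1 ≤ e * q := one_le_mul_of_one_le_of_one_le he1 hq
    have hlast : c (Fin.last ν) ≤ e * q * c (Fin.last ν) := le_mul_of_one_le_left hc' heq
    have heS : 0 ≤ e * S := mul_nonneg (by linarith) hS
    rcases Fin.eq_castSucc_or_eq_last j with ⟨i, rfl⟩ | rfl
    · have h1 : e * S ≤ q * (e * S) := le_mul_of_one_le_left heS hq
      nlinarith [key i]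
    · have h1 := hstep (Fin.last ν)
      rw [Fin.succ_last] at h1
      have h2 : (1 + L * h (Fin.last ν)) * r (Fin.last ν).castSucc ≤ q * (e * S) :=
        mul_le_mul hel (key _) (hr _) (by linarith)
      nlinarith

/-! ### Meshes -/

lemma Mesh.h_pos {T : ℝ} (Δ : Mesh T) (j : Fin Δ.ν) : 0 < Δ.h j :=
  sub_pos.2 (Δ.strictMono (Fin.castSucc_lt_succ))

lemma Mesh.castSucc_le_succ {T : ℝ} (Δ : Mesh T) (j : Fin Δ.ν) :
    Δ.t j.castSucc ≤ Δ.t j.succ :=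
  Δ.strictMono.monotone Fin.castSucc_lt_succ.le

lemma Mesh.t_mem {T : ℝ} (Δ : Mesh T) (j : Fin (Δ.ν + 1)) : Δ.t j ∈ Icc 0 T :=
  ⟨Δ.t_zero.symm.le.trans (Δ.strictMono.monotone (Fin.zero_le j)),
    (Δ.strictMono.monotone (Fin.le_last j)).trans Δ.t_last.le⟩

lemma Mesh.Icc_subset {T : ℝ} (Δ : Mesh T) (j : Fin Δ.ν) :
    Icc (Δ.t j.castSucc) (Δ.t j.succ) ⊆ Icc 0 T :=
  Icc_subset_Icc (Δ.t_mem _).1 (Δ.t_mem _).2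

lemma Mesh.sum_h {T : ℝ} (Δ : Mesh T) : ∑ j, Δ.h j = T := by
  have := sum_succ_sub_castSucc Δ.t
  rw [Δ.t_last, Δ.t_zero, sub_zero] at this
  exact this

lemma Mesh.sum_sub {T : ℝ} (Δ : Mesh T) (V : ℝ → ℝ) :
    ∑ j : Fin Δ.ν, (V (Δ.t j.succ) - V (Δ.t j.castSucc)) = V T - V 0 := by
  have := sum_succ_sub_castSucc (fun j => V (Δ.t j))
  rwa [Δ.t_last, Δ.t_zero] at this

/-! ### Functions of class `W^{1,2}` -/

section W12

variable {T : ℝ} {V : Type} [NormedAddCommGroup V] [NormedSpace ℝ V]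

lemma memLp_of_subset {W : Type} [NormedAddCommGroup W] {f : ℝ → W}
    (hf : MemLp f 2 (volume.restrict (Icc 0 T))) {s t : ℝ} (h : Icc s t ⊆ Icc 0 T) :
    MemLp f 2 (volume.restrict (Ioc s t)) :=
  hf.mono_measure (Measure.restrict_mono (Ioc_subset_Icc_self.trans h) le_rfl)

lemma intervalIntegrable_of_memLp {W : Type} [NormedAddCommGroup W] {f : ℝ → W}
    (hf : MemLp f 2 (volume.restrict (Icc 0 T))) {s t : ℝ} (hst : s ≤ t)
    (h : Icc s t ⊆ Icc 0 T) : IntervalIntegrable f volume s t := by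
  rw [intervalIntegrable_iff_integrableOn_Ioc_of_le hst]
  exact (memLp_of_subset hf h).integrable (by norm_num)

lemma W12.sub_eq_integral (f : W12 T V) {s t : ℝ} (hs : s ∈ Icc 0 T) (ht : t ∈ Icc 0 T)
    (hst : s ≤ t) : f.toFun t - f.toFun s = ∫ τ in s..t, f.vel τ := by
  rw [f.eq_integral t ht, f.eq_integral s hs]
  have h1 := intervalIntegrable_of_memLp f.memLp_vel hs.1 (Icc_subset_Icc_right hs.2)
  have h2 := intervalIntegrable_of_memLp f.memLp_vel hst (Icc_subset_Icc hs.1 ht.2)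
  rw [← intervalIntegral.integral_add_adjacent_intervals h1 h2]
  abel

lemma W12.continuousOn (f : W12 T V) : ContinuousOn f.toFun (Icc 0 T) := by
  rcases lt_or_ge T 0 with hT | hT
  · simp [Icc_eq_empty_of_lt hT]
  have h := intervalIntegrable_of_memLp f.memLp_vel hT subset_rfl
  have hc : ContinuousOn (fun t => f.toFun 0 + ∫ s in (0 : ℝ)..t, f.vel s) (Icc 0 T) := by
    have := intervalIntegral.continuousOn_primitive_interval' h (left_mem_uIcc)
    rw [uIcc_of_le hT] at this
    exact continuousOn_const.add this
  exact hc.congr fun t ht => f.eq_integral t ht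

lemma W12.memLp [FiniteDimensional ℝ V] (f : W12 T V) :
    MemLp f.toFun 2 (volume.restrict (Icc 0 T)) := by
  obtain ⟨C, hC⟩ := (isCompact_Icc.exists_bound_of_continuousOn f.continuousOn)
  exact MemLp.of_bound (f.continuousOn.aestronglyMeasurable measurableSet_Icc) C
    ((ae_restrict_iff' measurableSet_Icc).2 (Eventually.of_forall hC))

/-- The mean value of a function over an interval is as close to a given vector as the values. -/
lemma norm_smul_integral_sub_le [CompleteSpace V] {f : ℝ → V} {s t C : ℝ} (hst : s < t)
    (hf : IntervalIntegrable f volume s t) (v : V) (hv : ∀ τ ∈ Icc s t, ‖f τ - v‖ ≤ C) :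
    ‖(∫ τ in s..t, f τ) - (t - s) • v‖ ≤ (t - s) * C := by
  have h1 : (∫ τ in s..t, f τ) - (t - s) • v = ∫ τ in s..t, (f τ - v) := by
    rw [intervalIntegral.integral_sub hf intervalIntegrable_const,
      intervalIntegral.integral_const]
  rw [h1]
  have := intervalIntegral.norm_integral_le_of_norm_le_const (a := s) (b := t)
    (f := fun τ => f τ - v) (C := C)
    (fun τ hτ => hv τ (by rw [uIoc_of_le hst.le] at hτ; exact Ioc_subset_Icc_self hτ))
  rwa [abs_of_pos (sub_pos.2 hst), mul_comm] at this

end W12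

/-! ### Functions of bounded variation -/

/-- The variation from `0` to `t` serves as `G`. Bounding by increments of one function is what
later makes the errors telescope over a mesh. -/
lemma exists_monotone_of_boundedVariationOn {V : Type*} [NormedAddCommGroup V] {f : ℝ → V}
    {T : ℝ} (hf : BoundedVariationOn f (Icc 0 T)) :
    ∃ G : ℝ → ℝ, ∀ s ∈ Icc 0 T, ∀ t ∈ Icc 0 T, s ≤ t → ‖f s - f t‖ ≤ G t - G s := by
  refine ⟨fun t => variationOnFromTo f (Icc 0 T) 0 t, fun s hs t ht hst => ?_⟩
  have h0 : (0 : ℝ) ∈ Icc 0 T := ⟨le_rfl, hs.1.trans hs.2⟩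
  have hadd := variationOnFromTo.add hf.locallyBoundedVariationOn h0 hs ht
  have : ‖f s - f t‖ ≤ variationOnFromTo f (Icc 0 T) s t := by
    rw [variationOnFromTo.eq_of_le f _ hst, ← dist_eq_norm]
    have hb : BoundedVariationOn f (Icc 0 T ∩ Icc s t) := hf.mono inter_subset_left
    exact hb.dist_le ⟨hs, le_rfl, hst⟩ ⟨ht, hst, le_rfl⟩
  linarith

/-! ### Normal cones -/

/-- The Slater condition for the polyhedron `C(a, b)`. -/
def Slater (a : A n m) (b : E m) : Prop := ∃ x : E n, ∀ i, inner ℝ (a i) x < b i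

lemma continuous_inner_component (x : E n) (i : Fin m) :
    Continuous fun a : A n m => (inner ℝ (a i) x : ℝ) := by fun_prop

lemma isOpen_slater : IsOpen {p : A n m × E m | Slater p.1 p.2} := by
  have : {p : A n m × E m | Slater p.1 p.2} =
      ⋃ x : E n, ⋂ i, {p : A n m × E m | inner ℝ (p.1 i) x < p.2 i} := by
    ext p; simp [Slater]
  rw [this]
  refine isOpen_iUnion fun x => isOpen_iInter_of_finite fun i => isOpen_lt ?_ ?_ <;> fun_prop

lemma polyhedron_mem_of_tendsto {ι : Type*} {l : Filter ι} [l.NeBot] {x : ι → E n}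
    {a : ι → A n m} {b : ι → E m} {x' : E n} {a' : A n m} {b' : E m}
    (hx : Tendsto x l (𝓝 x')) (ha : Tendsto a l (𝓝 a')) (hb : Tendsto b l (𝓝 b'))
    (h : ∀ᶠ k in l, x k ∈ polyhedron (a k) (b k)) : x' ∈ polyhedron a' b' := by
  intro i
  have hai : Tendsto (fun k => a k i) l (𝓝 (a' i)) :=
    ((by fun_prop : Continuous fun a : A n m => a i).tendsto a').comp ha
  have hbi : Tendsto (fun k => b k i) l (𝓝 (b' i)) :=
    ((by fun_prop : Continuous fun b : E m => b i).tendsto b').comp hb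
  exact le_of_tendsto_of_tendsto (hai.inner hx) hbi (h.mono fun k hk => hk i)

/-- Under the Slater condition, the normal cone to `C(a, b)` at `x` has closed graph as a
function of `(x, a, b)`. -/
lemma normalCone_mem_of_tendsto {ι : Type*} {l : Filter ι} [l.NeBot] {x v : ι → E n}
    {a : ι → A n m} {b : ι → E m} {x' v' : E n} {a' : A n m} {b' : E m}
    (hx : Tendsto x l (𝓝 x')) (hv : Tendsto v l (𝓝 v')) (ha : Tendsto a l (𝓝 a'))
    (hb : Tendsto b l (𝓝 b')) (hs : Slater a' b')
    (h : ∀ᶠ k in l, v k ∈ normalCone (x k) (polyhedron (a k) (b k))) :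
    v' ∈ normalCone x' (polyhedron a' b') := by
  refine ⟨polyhedron_mem_of_tendsto hx ha hb (h.mono fun k hk => hk.1), fun y hy => ?_⟩
  obtain ⟨p, hp⟩ := hs
  -- The test point `y` may lie outside the approximating polyhedra. Moved slightly towards the
  -- Slater point `p`, it satisfies all limit inequalities strictly and so belongs to them
  -- eventually; afterwards `s` tends to `0`.
  have hstrict : ∀ s ∈ Ioc (0 : ℝ) 1, inner ℝ v' (y + s • (p - y) - x') ≤ 0 := by
    intro s hs'
    have hmem : ∀ i, inner ℝ (a' i) (y + s • (p - y)) < b' i := by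
      intro i
      have h1 := hy i
      have h2 := hp i
      rw [inner_add_right, inner_smul_right, inner_sub_right]
      nlinarith [hs'.1, hs'.2]
    have hev : ∀ᶠ k in l, y + s • (p - y) ∈ polyhedron (a k) (b k) := by
      have : ∀ᶠ k in l, ∀ i, inner ℝ (a k i) (y + s • (p - y)) < b k i := by
        rw [eventually_all]
        intro i
        have hai := ((continuous_inner_component (y + s • (p - y)) i).tendsto a').comp ha
        have hbi : Tendsto (fun k => b k i) l (𝓝 (b' i)) :=
          ((by fun_prop : Continuous fun b : E m => b i).tendsto b').comp hb
        exact hai.eventually_lt hbi (hmem i)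
      exact this.mono fun k hk i => (hk i).le
    refine le_of_tendsto (hv.inner (tendsto_const_nhds.sub hx)) ?_
    filter_upwards [h, hev] with k hk hk' using hk.2 _ hk'
  have hc : Tendsto (fun s : ℝ => (inner ℝ v' (y + s • (p - y) - x') : ℝ)) (𝓝[>] 0)
      (𝓝 (inner ℝ v' (y + (0 : ℝ) • (p - y) - x'))) :=
    (Continuous.tendsto (by fun_prop) 0).mono_left nhdsWithin_le_nhds
  simp only [zero_smul, add_zero] at hc
  exact le_of_tendsto hc (by
    filter_upwards [Ioc_mem_nhdsGT (zero_lt_one' ℝ)] with s hs using hstrict s hs)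

/-- Translating a polyhedron translates its normal cones. -/
lemma normalCone_translate {a : A n m} {b b' : E m} {x y v : E n}
    (hb : ∀ i, b' i = b i + inner ℝ (a i) y) (hv : v ∈ normalCone x (polyhedron a b)) :
    v ∈ normalCone (x + y) (polyhedron a b') := by
  have h : ∀ p, p ∈ polyhedron a b' ↔ p - y ∈ polyhedron a b := fun p => by
    refine forall_congr' fun i => ?_
    rw [hb, inner_sub_right, sub_le_iff_le_add]
  refine ⟨(h _).2 (by simpa using hv.1), fun p hp => ?_⟩
  have := hv.2 _ ((h p).1 hp)
  rwa [show p - (x + y) = p - y - x by abel]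

/-- Zero is normal at every point of a set, so membership is a special case of
`normalCone_translate`. -/
lemma polyhedron_translate {a : A n m} {b b' : E m} {x y : E n}
    (hb : ∀ i, b' i = b i + inner ℝ (a i) y) (hx : x ∈ polyhedron a b) :
    x + y ∈ polyhedron a b' :=
  (normalCone_translate (v := 0) hb ⟨hx, by simp⟩).1

/-- The Slater condition holds along `z`. -/
lemma UniformSlater.slater {P : Data n m d} {z : Quad P} (h : UniformSlater z) {t : ℝ}
    (ht : t ∈ Icc 0 P.T) : Slater (z.a.toFun t) (z.b.toFun t) := by
  obtain ⟨-, θ, hθ, hneg, hx⟩ := h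
  obtain ⟨x, hx⟩ := hx t ht
  have : θ t ≤ sSup (θ '' Icc 0 P.T) :=
    le_csSup (isCompact_Icc.image_of_continuousOn hθ).bddAbove (mem_image_of_mem _ ht)
  exact ⟨x, fun i => by linarith [hx i]⟩

/-- The Slater condition holds uniformly near the trajectory of `(a, b)`. -/
lemma UniformSlater.exists_radius {P : Data n m d} {z : Quad P} (h : UniformSlater z) :
    ∃ r > 0, ∀ t ∈ Icc 0 P.T, ∀ a b, ‖a - z.a.toFun t‖ < r → ‖b - z.b.toFun t‖ < r →
      Slater a b := by
  have hK : IsCompact ((fun t => (z.a.toFun t, z.b.toFun t)) '' Icc 0 P.T) :=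
    isCompact_Icc.image_of_continuousOn (z.a.continuousOn.prodMk z.b.continuousOn)
  obtain ⟨r, hr, hsub⟩ := hK.exists_thickening_subset_open isOpen_slater (by
    rintro _ ⟨t, ht, rfl⟩
    exact h.slater ht)
  refine ⟨r, hr, fun t ht a b ha hb => ?_⟩
  have : (a, b) ∈ {p : A n m × E m | Slater p.1 p.2} := hsub (by
    rw [Metric.mem_thickening_iff]
    refine ⟨_, mem_image_of_mem _ ht, ?_⟩
    rw [Prod.dist_eq, dist_eq_norm, dist_eq_norm]
    exact max_lt ha hb)
  exact this

/-! ### Existence of feasible points -/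

/-- The Lipschitz estimate is available only for controls in `U`; hence the sequential form, with
the limit control in `U` as well. -/
lemma tendsto_perturbation {P : Data n m d} {L : ℝ}
    (hg : ∀ x₁ x₂, ∀ u₁ ∈ P.U, ∀ u₂ ∈ P.U,
      ‖P.g x₁ u₁ - P.g x₂ u₂‖ ≤ L * (‖x₁ - x₂‖ + ‖u₁ - u₂‖))
    {ι : Type*} {l : Filter ι} {x : ι → E n} {u : ι → E d} {x' : E n} {u' : E d}
    (hx : Tendsto x l (𝓝 x')) (hu : Tendsto u l (𝓝 u')) (hU : ∀ᶠ k in l, u k ∈ P.U)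
    (hU' : u' ∈ P.U) : Tendsto (fun k => P.g (x k) (u k)) l (𝓝 (P.g x' u')) := by
  rw [tendsto_iff_norm_sub_tendsto_zero] at hx hu ⊢
  have h0 : Tendsto (fun k => L * (‖x k - x'‖ + ‖u k - u'‖)) l (𝓝 0) := by
    simpa using (hx.add hu).const_mul L
  exact squeeze_zero' (Eventually.of_forall fun k => norm_nonneg _)
    (hU.mono fun k hk => hg _ _ _ hk _ hU') h0

/-- Properties that hold almost everywhere hold arbitrarily close on the right of any time. -/
lemma frequently_nhdsGT_of_ae {T s : ℝ} (hs : 0 ≤ s) (hsT : s < T) {p : ℝ → Prop}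
    (hp : ∀ᵐ t ∂(volume.restrict (Icc 0 T)), p t) : ∃ᶠ t in 𝓝[>] s, p t := by
  intro hnot
  obtain ⟨r, hr, hsub⟩ := (mem_nhdsGT_iff_exists_Ioo_subset' hsT).1 hnot
  rw [ae_restrict_iff' measurableSet_Icc] at hp
  have h0 : volume (Ioo s (min r T)) = 0 := by
    refine measure_mono_null (fun t ht => ?_) (ae_iff.1 hp)
    intro hmem
    exact hsub ⟨ht.1, ht.2.trans_le (min_le_left _ _)⟩
      (hmem ⟨hs.trans ht.1.le, (ht.2.trans_le (min_le_right _ _)).le⟩)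
  rw [Real.volume_Ioo, ENNReal.ofReal_eq_zero] at h0
  have := lt_min (show s < r from hr) hsT
  linarith

/-- The hypothesis forces `G` to be monotone on the interval, so any two values differ by at most
its full increment. -/
lemma oscillation_le {V : Type*} [NormedAddCommGroup V] {f : ℝ → V} {G : ℝ → ℝ} {T : ℝ}
    (hf : ∀ s ∈ Icc 0 T, ∀ t ∈ Icc 0 T, s ≤ t → ‖f s - f t‖ ≤ G t - G s)
    {s t : ℝ} (hst : Icc s t ⊆ Icc 0 T) {σ τ : ℝ} (hσ : σ ∈ Icc s t) (hτ : τ ∈ Icc s t) :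
    ‖f σ - f τ‖ ≤ G t - G s := by
  have hs : s ∈ Icc s t := ⟨le_rfl, hσ.1.trans hσ.2⟩
  have ht : t ∈ Icc s t := ⟨hσ.1.trans hσ.2, le_rfl⟩
  have mono : ∀ σ ∈ Icc s t, ∀ τ ∈ Icc s t, σ ≤ τ → G σ ≤ G τ := fun σ hσ τ hτ h => by
    linarith [(norm_nonneg _).trans (hf σ (hst hσ) τ (hst hτ) h)]
  have h1 := mono s hs σ hσ hσ.1
  have h2 := mono s hs τ hτ hτ.1
  have h3 := mono σ hσ t ht hσ.2
  have h4 := mono τ hτ t ht hτ.2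
  rcases le_total σ τ with h | h
  · linarith [hf σ (hst hσ) τ (hst hτ) h]
  · rw [norm_sub_rev]
    linarith [hf τ (hst hτ) σ (hst hσ) h]

/-- On every interval, some admissible control and velocity at the left end are uniformly close
to those of `z`. -/
lemma exists_control_velocity {P : Data n m d} {z : Quad P} (hz : z.Feasible)
    (hU : IsClosed P.U) {L : ℝ} (hL : 0 ≤ L)
    (hg : ∀ x₁ x₂, ∀ u₁ ∈ P.U, ∀ u₂ ∈ P.U,
      ‖P.g x₁ u₁ - P.g x₂ u₂‖ ≤ L * (‖x₁ - x₂‖ + ‖u₁ - u₂‖))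
    (hS : UniformSlater z) {G : ℝ → ℝ}
    (hGx : ∀ s ∈ Icc 0 P.T, ∀ t ∈ Icc 0 P.T, s ≤ t → ‖z.x.vel s - z.x.vel t‖ ≤ G t - G s)
    (hGu : ∀ s ∈ Icc 0 P.T, ∀ t ∈ Icc 0 P.T, s ≤ t → ‖z.u s - z.u t‖ ≤ G t - G s)
    (hu0 : z.u 0 ∈ P.U) {s t : ℝ} (hst : s < t) (hsub : Icc s t ⊆ Icc 0 P.T) :
    ∃ u ∈ P.U, (s = 0 → u = z.u 0) ∧
      ∃ w ∈ normalCone (z.x.toFun s) (polyhedron (z.a.toFun s) (z.b.toFun s)),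
        ∀ τ ∈ Icc s t, ‖u - z.u τ‖ ≤ G t - G s ∧
          ‖-w + P.g (z.x.toFun s) u - z.x.vel τ‖ ≤ (1 + L) * (G t - G s) := by
  have hs : s ∈ Icc 0 P.T := hsub ⟨le_rfl, hst.le⟩
  have ht : t ∈ Icc 0 P.T := hsub ⟨hst.le, le_rfl⟩
  -- The inclusion holds only almost everywhere and may fail at `s` itself, so good times decreasing
  -- to `s` are used instead.
  have hfreq : ∃ᶠ τ in 𝓝[>] s, (z.u τ ∈ P.U ∧ -(z.x.vel τ) ∈ P.F (z.pos τ) (z.u τ)) ∧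
      τ ∈ Ioo s t :=
    (frequently_nhdsGT_of_ae hs.1 (hst.trans_le ht.2)
      (hz.control.and hz.inclusion)).and_eventually (Ioo_mem_nhdsGT hst)
  obtain ⟨σ, hσ, hgood⟩ := exists_seq_forall_of_frequently hfreq
  have hmem : ∀ l, σ l ∈ Icc s t := fun l => Ioo_subset_Icc_self (hgood l).2
  have hsI : s ∈ Icc s t := ⟨le_rfl, hst.le⟩
  have hbdd : Bornology.IsBounded (Metric.closedBall (z.x.vel s) (G t - G s) ×ˢ
      Metric.closedBall (z.u s) (G t - G s)) :=
    Metric.isBounded_closedBall.prod Metric.isBounded_closedBall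
  obtain ⟨⟨v, u⟩, -, κ, hκ, hlim⟩ := tendsto_subseq_of_bounded hbdd
    (x := fun l => (z.x.vel (σ l), z.u (σ l))) (fun l => by
      refine ⟨?_, ?_⟩
      · rw [Metric.mem_closedBall, dist_eq_norm]
        exact oscillation_le hGx hsub (hmem l) hsI
      · rw [Metric.mem_closedBall, dist_eq_norm]
        exact oscillation_le hGu hsub (hmem l) hsI)
  have hv : Tendsto (fun l => z.x.vel (σ (κ l))) atTop (𝓝 v) := (continuous_fst.tendsto _).comp hlim
  have hu : Tendsto (fun l => z.u (σ (κ l))) atTop (𝓝 u) := (continuous_snd.tendsto _).comp hlim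
  have huU : u ∈ P.U := hU.mem_of_tendsto hu (Eventually.of_forall fun l => (hgood _).1.1)
  have hσκ : Tendsto (fun l => σ (κ l)) atTop (𝓝[Icc 0 P.T] s) :=
    tendsto_nhdsWithin_iff.2 ⟨(hσ.mono_right nhdsWithin_le_nhds).comp hκ.tendsto_atTop,
      Eventually.of_forall fun l => hsub (hmem _)⟩
  have hx : Tendsto (fun l => z.x.toFun (σ (κ l))) atTop (𝓝 (z.x.toFun s)) :=
    (z.x.continuousOn s hs).tendsto.comp hσκ
  have ha : Tendsto (fun l => z.a.toFun (σ (κ l))) atTop (𝓝 (z.a.toFun s)) :=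
    (z.a.continuousOn s hs).tendsto.comp hσκ
  have hb : Tendsto (fun l => z.b.toFun (σ (κ l))) atTop (𝓝 (z.b.toFun s)) :=
    (z.b.continuousOn s hs).tendsto.comp hσκ
  have hgl := tendsto_perturbation hg hx hu (Eventually.of_forall fun l => (hgood _).1.1) huU
  -- The normals at the good times are determined by velocity and control, hence converge; the
  -- closed graph puts the limit in the cone at time `s`.
  have hcone : -v + P.g (z.x.toFun s) u ∈
      normalCone (z.x.toFun s) (polyhedron (z.a.toFun s) (z.b.toFun s)) := by
    refine normalCone_mem_of_tendsto hx (hv.neg.add hgl) ha hb (hS.slater hs)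
      (Eventually.of_forall fun l => ?_)
    obtain ⟨w, hw, heq⟩ := (hgood (κ l)).1.2
    have : -z.x.vel (σ (κ l)) + P.g (z.x.toFun (σ (κ l))) (z.u (σ (κ l))) = w := by
      rw [heq, Quad.pos]; abel
    rw [this]; exact hw
  have hvτ : ∀ τ ∈ Icc s t, ‖v - z.x.vel τ‖ ≤ G t - G s := fun τ hτ =>
    le_of_tendsto (hv.sub_const _).norm
      (Eventually.of_forall fun l => oscillation_le hGx hsub (hmem _) hτ)
  have huτ : ∀ τ ∈ Icc s t, ‖u - z.u τ‖ ≤ G t - G s := fun τ hτ =>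
    le_of_tendsto (hu.sub_const _).norm
      (Eventually.of_forall fun l => oscillation_le hGu hsub (hmem _) hτ)
  -- At `s = 0` the control is prescribed and can differ from the right limit `u`. The normal built
  -- from `u` is kept and only the control is replaced; through `g` this costs the extra `L` in the
  -- factor `1 + L`.
  obtain ⟨u', hu'U, hu'0, hu'τ, huu'⟩ : ∃ u' ∈ P.U, (s = 0 → u' = z.u 0) ∧
      (∀ τ ∈ Icc s t, ‖u' - z.u τ‖ ≤ G t - G s) ∧ ‖u' - u‖ ≤ G t - G s := by
    by_cases h0 : s = 0
    · subst h0
      exact ⟨_, hu0, fun _ => rfl, fun τ hτ => oscillation_le hGu hsub hsI hτ,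
        norm_sub_rev u (z.u 0) ▸ huτ 0 hsI⟩
    · refine ⟨u, huU, fun h => absurd h h0, huτ, ?_⟩
      rw [sub_self, norm_zero]
      exact (norm_nonneg _).trans (huτ s hsI)
  refine ⟨u', hu'U, hu'0, _, hcone, fun τ hτ => ⟨hu'τ τ hτ, ?_⟩⟩
  have h1 := hg (z.x.toFun s) (z.x.toFun s) u' hu'U u huU
  rw [sub_self, norm_zero, zero_add] at h1
  calc ‖-(-v + P.g (z.x.toFun s) u) + P.g (z.x.toFun s) u' - z.x.vel τ‖
      = ‖(v - z.x.vel τ) + (P.g (z.x.toFun s) u' - P.g (z.x.toFun s) u)‖ := by congr 1; abel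
    _ ≤ ‖v - z.x.vel τ‖ + ‖P.g (z.x.toFun s) u' - P.g (z.x.toFun s) u‖ := norm_add_le _ _
    _ ≤ (1 + L) * (G t - G s) := by nlinarith [hvτ τ hτ]

/-- The vector of the inner products `⟨aᵢ, y⟩`. -/
noncomputable def pairing (a : A n m) (y : E n) : E m := WithLp.toLp 2 fun i => inner ℝ (a i) y

lemma pairing_apply (a : A n m) (y : E n) (i : Fin m) : pairing a y i = inner ℝ (a i) y := rfl

lemma norm_pairing_le (a : A n m) (y : E n) : ‖pairing a y‖ ≤ ‖a‖ * ‖y‖ := by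
  refine le_of_sq_le_sq ?_ (by positivity)
  rw [mul_pow, EuclideanSpace.norm_sq_eq, PiLp.norm_sq_eq_of_L2, Finset.sum_mul]
  refine Finset.sum_le_sum fun i _ => ?_
  rw [← mul_pow, pairing_apply]
  exact pow_le_pow_left₀ (norm_nonneg _) (norm_inner_le_norm _ _) 2

/-- A discrete product rule: it separates the increment of `y` from that of `a`, so that difference
quotients of the correction of `b` can be estimated. -/
lemma pairing_sub (a a' : A n m) (y y' : E n) :
    pairing a' y' - pairing a y = pairing a' (y' - y) + pairing (a' - a) y := by
  ext i
  simp only [pairing_apply, PiLp.sub_apply, PiLp.add_apply, inner_sub_left, inner_sub_right]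
  ring

lemma W12.norm_sub_le {T : ℝ} {V : Type} [NormedAddCommGroup V] [NormedSpace ℝ V]
    (f : W12 T V) {B : ℝ} (hB : ∀ t ∈ Icc 0 T, ‖f.vel t‖ ≤ B) {s t : ℝ} (hst : s ≤ t)
    (hsub : Icc s t ⊆ Icc 0 T) : ‖f.toFun t - f.toFun s‖ ≤ B * (t - s) := by
  rw [f.sub_eq_integral (hsub ⟨le_rfl, hst⟩) (hsub ⟨hst, le_rfl⟩) hst]
  have := intervalIntegral.norm_integral_le_of_norm_le_const (a := s) (b := t)
    (f := f.vel) (C := B) (fun τ hτ => hB τ (hsub (by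
      rw [uIoc_of_le hst] at hτ; exact Ioc_subset_Icc_self hτ)))
  rwa [abs_of_nonneg (sub_nonneg.2 hst)] at this

lemma W12.norm_slope_sub_vel_le {T : ℝ} {V : Type} [NormedAddCommGroup V] [NormedSpace ℝ V]
    [CompleteSpace V] (f : W12 T V) {G : ℝ → ℝ}
    (hG : ∀ s ∈ Icc 0 T, ∀ t ∈ Icc 0 T, s ≤ t → ‖f.vel s - f.vel t‖ ≤ G t - G s)
    {s t τ : ℝ} (hst : s < t) (hsub : Icc s t ⊆ Icc 0 T) (hτ : τ ∈ Icc s t) :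
    ‖(f.toFun t - f.toFun s) - (t - s) • f.vel τ‖ ≤ (t - s) * (G t - G s) := by
  rw [f.sub_eq_integral (hsub ⟨le_rfl, hst.le⟩) (hsub ⟨hst.le, le_rfl⟩) hst.le]
  exact norm_smul_integral_sub_le hst (intervalIntegrable_of_memLp f.memLp_vel hst.le hsub) _
    fun σ hσ => oscillation_le hG hsub hσ hτ

lemma norm_inv_smul_sub_le {V : Type*} [NormedAddCommGroup V] [NormedSpace ℝ V] {h C : ℝ}
    (hh : 0 < h) {p v : V} (hp : ‖p - h • v‖ ≤ h * C) : ‖h⁻¹ • p - v‖ ≤ C := by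
  have : h⁻¹ • p - v = h⁻¹ • (p - h • v) := by rw [smul_sub, inv_smul_smul₀ hh.ne']
  rw [this, norm_smul, norm_inv, Real.norm_of_nonneg hh.le, inv_mul_le_iff₀ hh]
  exact hp

lemma exists_bound_vel {V : Type*} [NormedAddCommGroup V] {f : ℝ → V} {G : ℝ → ℝ} {T : ℝ}
    (hf : ∀ s ∈ Icc 0 T, ∀ t ∈ Icc 0 T, s ≤ t → ‖f s - f t‖ ≤ G t - G s) (t : ℝ)
    (ht : t ∈ Icc 0 T) : ‖f t‖ ≤ ‖f 0‖ + (G T - G 0) := by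
  have h0T : (0 : ℝ) ≤ T := ht.1.trans ht.2
  have := oscillation_le hf subset_rfl ht (left_mem_Icc.2 h0T)
  have h2 := norm_add_le (f 0) (f t - f 0)
  rw [add_sub_cancel] at h2
  linarith

/-- The sum of the four variation functions dominates each of them, since every increment is
nonnegative. -/
lemma BVQuad.exists_monotone {P : Data n m d} {z : Quad P} (h : BVQuad z) :
    ∃ G : ℝ → ℝ, ∀ s ∈ Icc 0 P.T, ∀ t ∈ Icc 0 P.T, s ≤ t →
      ‖z.x.vel s - z.x.vel t‖ ≤ G t - G s ∧ ‖z.a.vel s - z.a.vel t‖ ≤ G t - G s ∧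
      ‖z.b.vel s - z.b.vel t‖ ≤ G t - G s ∧ ‖z.u s - z.u t‖ ≤ G t - G s := by
  obtain ⟨G₁, h₁⟩ := exists_monotone_of_boundedVariationOn h.1
  obtain ⟨G₂, h₂⟩ := exists_monotone_of_boundedVariationOn h.2.1
  obtain ⟨G₃, h₃⟩ := exists_monotone_of_boundedVariationOn h.2.2.1
  obtain ⟨G₄, h₄⟩ := exists_monotone_of_boundedVariationOn h.2.2.2
  refine ⟨fun t => G₁ t + G₂ t + G₃ t + G₄ t, fun s hs t ht hst => ?_⟩
  have e₁ := h₁ s hs t ht hst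
  have e₂ := h₂ s hs t ht hst
  have e₃ := h₃ s hs t ht hst
  have e₄ := h₄ s hs t ht hst
  have p₁ := (norm_nonneg _).trans e₁
  have p₂ := (norm_nonneg _).trans e₂
  have p₃ := (norm_nonneg _).trans e₃
  have p₄ := (norm_nonneg _).trans e₄
  refine ⟨?_, ?_, ?_, ?_⟩ <;> linarith

set_option maxHeartbeats 1000000 in
/-- Discrete trajectories that approximate `z`, with an error controlled by the step size and by
the variation `G` of the velocities and of the control of `z` over one step. -/
lemma exists_discrete_approximation {P : Data n m d} {z : Quad P} (hz : z.Feasible)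
    (hU : IsClosed P.U) (hg : PerturbationRegular P) (hS : UniformSlater z) {G : ℝ → ℝ}
    (hG : ∀ s ∈ Icc 0 P.T, ∀ t ∈ Icc 0 P.T, s ≤ t →
      ‖z.x.vel s - z.x.vel t‖ ≤ G t - G s ∧ ‖z.a.vel s - z.a.vel t‖ ≤ G t - G s ∧
      ‖z.b.vel s - z.b.vel t‖ ≤ G t - G s ∧ ‖z.u s - z.u t‖ ≤ G t - G s)
    (hu0 : z.u 0 ∈ P.U) :
    ∃ C : ℝ, 0 ≤ C ∧ ∀ (Δ : Mesh P.T) (η : ℝ), 0 ≤ η → (∀ j, Δ.h j ≤ η) →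
      ∃ w : DiscreteQuad n m d Δ.ν,
        (∀ j : Fin Δ.ν, ∃ v ∈ P.F (w.pos j.castSucc) (w.u j),
          w.x j.succ = w.x j.castSucc - Δ.h j • v) ∧
        w.x (Fin.last Δ.ν) ∈ polyhedron (w.a (Fin.last Δ.ν)) (w.b (Fin.last Δ.ν)) ∧
        w.pos 0 = z.pos 0 ∧
        (∀ j : Fin Δ.ν, (j : ℕ) = 0 → w.u j = z.u 0) ∧ (∀ j, w.u j ∈ P.U) ∧
        (∀ j, w.a j = z.a.toFun (Δ.t j)) ∧
        ∀ j : Fin Δ.ν, ∀ τ ∈ Icc (Δ.t j.castSucc) (Δ.t j.succ),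
          ∀ D, D = C * (η + (G (Δ.t j.succ) - G (Δ.t j.castSucc))) →
          (‖w.x j.castSucc - z.x.toFun τ‖ ≤ D ∧ ‖w.a j.castSucc - z.a.toFun τ‖ ≤ D ∧
            ‖w.b j.castSucc - z.b.toFun τ‖ ≤ D ∧ ‖w.u j - z.u τ‖ ≤ D) ∧
          ‖(w.vel Δ j).1 - z.x.vel τ‖ ≤ D ∧ ‖(w.vel Δ j).2.1 - z.a.vel τ‖ ≤ D ∧
            ‖(w.vel Δ j).2.2 - z.b.vel τ‖ ≤ D := by
  obtain ⟨⟨L, hL, hgL⟩, -⟩ := hg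
  have hGx := fun s hs t ht hst => (hG s hs t ht hst).1
  have hGa := fun s hs t ht hst => (hG s hs t ht hst).2.1
  have hGb := fun s hs t ht hst => (hG s hs t ht hst).2.2.1
  have hGu := fun s hs t ht hst => (hG s hs t ht hst).2.2.2
  have hGmono : ∀ {s t : ℝ}, s ≤ t → Icc s t ⊆ Icc 0 P.T → 0 ≤ G t - G s := fun hst hsub =>
    (norm_nonneg _).trans (hGx _ (hsub (left_mem_Icc.2 hst)) _ (hsub (right_mem_Icc.2 hst)) hst)
  set GT := G P.T - G 0
  have hGT : 0 ≤ GT := hGmono P.T_pos.le subset_rfl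
  obtain ⟨B, hB0, hBx, hBa, hBb⟩ : ∃ B : ℝ, 0 ≤ B ∧ (∀ t ∈ Icc 0 P.T, ‖z.x.vel t‖ ≤ B) ∧
      (∀ t ∈ Icc 0 P.T, ‖z.a.vel t‖ ≤ B) ∧ (∀ t ∈ Icc 0 P.T, ‖z.b.vel t‖ ≤ B) := by
    have p₁ := norm_nonneg (z.x.vel 0)
    have p₂ := norm_nonneg (z.a.vel 0)
    have p₃ := norm_nonneg (z.b.vel 0)
    refine ⟨‖z.x.vel 0‖ + ‖z.a.vel 0‖ + ‖z.b.vel 0‖ + GT, by positivity, fun t ht => ?_,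
      fun t ht => ?_, fun t ht => ?_⟩
    · linarith [exists_bound_vel hGx t ht]
    · linarith [exists_bound_vel hGa t ht]
    · linarith [exists_bound_vel hGb t ht]
  obtain ⟨A₀, hA₀⟩ := isCompact_Icc.exists_bound_of_continuousOn z.a.continuousOn
  have hA₀0 : 0 ≤ A₀ := (norm_nonneg _).trans (hA₀ 0 ⟨le_rfl, P.T_pos.le⟩)
  -- `K₁ * η` will bound the deviation `y` of the scheme from the trajectory, and `K₂ * (η + D j)`
  -- its difference quotients.
  set K₁ := Real.exp (L * P.T) * ((1 + L) * GT) with hK₁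
  have hK₁0 : 0 ≤ K₁ := by positivity
  set K₂ := (1 + L) + L * K₁ with hK₂
  have hK₂0 : 0 ≤ K₂ := by positivity
  -- The summands account for the variation over a step (`1`), the velocity of `x` (`K₂`), the
  -- deviation `y` (`K₁`), the motion of `z` within a step (`B`), the correction of `b` (`A₀ * K₁`)
  -- and its velocity (`A₀ * K₂ + B * K₁`).
  refine ⟨1 + K₂ + K₁ + B + A₀ * K₁ + A₀ * K₂ + B * K₁, by positivity, fun Δ η hη hΔ => ?_⟩
  have hstep : ∀ j : Fin Δ.ν, _ := fun j =>
    exists_control_velocity hz hU hL.le hgL hS hGx hGu hu0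
      (Δ.strictMono (Fin.castSucc_lt_succ (i := j))) (Δ.Icc_subset j)
  choose u huU hu0' p hp hbound using hstep
  -- Explicit Euler scheme: the normal `p j` is the one chosen on the reference trajectory, while
  -- the perturbation is evaluated at the discrete point.
  set x : Fin (Δ.ν + 1) → E n := Fin.induction (motive := fun _ => E n) (z.x.toFun 0)
    (fun j y => y + Δ.h j • (-p j + P.g y (u j))) with hxdef
  have hx0 : x 0 = z.x.toFun 0 := rfl
  have hxs : ∀ j : Fin Δ.ν, x j.succ =
      x j.castSucc + Δ.h j • (-p j + P.g (x j.castSucc) (u j)) := fun j => by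
    rw [hxdef, Fin.induction_succ]
  clear_value x
  set y : Fin (Δ.ν + 1) → E n := fun j => x j - z.x.toFun (Δ.t j) with hy
  set D : Fin Δ.ν → ℝ := fun j => G (Δ.t j.succ) - G (Δ.t j.castSucc) with hD
  have hD0 : ∀ j, 0 ≤ D j := fun j => hGmono (Δ.castSucc_le_succ j) (Δ.Icc_subset j)
  have hDsum : ∑ j, D j = GT := Δ.sum_sub G
  have hvelg : ∀ j : Fin Δ.ν, ‖P.g (x j.castSucc) (u j) - P.g (z.x.toFun (Δ.t j.castSucc)) (u j)‖
      ≤ L * ‖y j.castSucc‖ := fun j => by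
    have := hgL (x j.castSucc) (z.x.toFun (Δ.t j.castSucc)) _ (huU j) _ (huU j)
    rwa [sub_self, norm_zero, add_zero] at this
  have hyd : ∀ j : Fin Δ.ν, ‖y j.succ - y j.castSucc‖ ≤
      Δ.h j * ((1 + L) * D j + L * ‖y j.castSucc‖) := fun j => by
    have hint := norm_smul_integral_sub_le (Δ.strictMono (Fin.castSucc_lt_succ (i := j)))
      (intervalIntegrable_of_memLp z.x.memLp_vel (Δ.castSucc_le_succ j) (Δ.Icc_subset j))
      (-p j + P.g (z.x.toFun (Δ.t j.castSucc)) (u j))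
      (fun τ hτ => (norm_sub_rev _ _).trans_le (hbound j τ hτ).2)
    rw [← z.x.sub_eq_integral (Δ.t_mem _) (Δ.t_mem _) (Δ.castSucc_le_succ j)] at hint
    change ‖_ - Δ.h j • _‖ ≤ Δ.h j * _ at hint
    have heq : y j.succ - y j.castSucc =
        Δ.h j • (P.g (x j.castSucc) (u j) - P.g (z.x.toFun (Δ.t j.castSucc)) (u j)) -
        (z.x.toFun (Δ.t j.succ) - z.x.toFun (Δ.t j.castSucc) -
          Δ.h j • (-p j + P.g (z.x.toFun (Δ.t j.castSucc)) (u j))) := by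
      simp only [hy, hxs, smul_add, smul_sub, smul_neg]
      abel
    rw [heq]
    refine (norm_sub_le _ _).trans ?_
    rw [norm_smul, Real.norm_of_nonneg (Δ.h_pos j).le]
    have := mul_le_mul_of_nonneg_left (hvelg j) (Δ.h_pos j).le
    nlinarith
  -- The local errors `h j * (1 + L) * D j` sum to at most `η * (1 + L) * GT`, since the `D j`
  -- telescope; Gronwall then gives a bound linear in `η`.
  have hyK : ∀ j, ‖y j‖ ≤ K₁ * η := fun j => by
    have h1 := discrete_gronwall (fun j => ‖y j‖) Δ.h (fun j => Δ.h j * ((1 + L) * D j)) L hL.le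
      (fun j => (Δ.h_pos j).le)
      (fun j => mul_nonneg (Δ.h_pos j).le (mul_nonneg (by linarith) (hD0 j)))
      (by simp [hy, hx0, Δ.t_zero]) (fun j => norm_nonneg _) (fun j => by
        have e1 := norm_add_le (y j.castSucc) (y j.succ - y j.castSucc)
        rw [add_sub_cancel] at e1
        linarith [hyd j]) j
    rw [Δ.sum_h] at h1
    have h2 : ∑ j, Δ.h j * ((1 + L) * D j) ≤ η * ((1 + L) * GT) := by
      rw [← hDsum, Finset.mul_sum, Finset.mul_sum]
      exact Finset.sum_le_sum fun j _ => mul_le_mul_of_nonneg_right (hΔ j)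
        (mul_nonneg (by linarith) (hD0 j))
    calc ‖y j‖ ≤ _ := h1
      _ ≤ Real.exp (L * P.T) * (η * ((1 + L) * GT)) :=
        mul_le_mul_of_nonneg_left h2 (Real.exp_pos _).le
      _ = K₁ * η := by rw [hK₁]; ring
  have hydK : ∀ j : Fin Δ.ν, ‖y j.succ - y j.castSucc‖ ≤ Δ.h j * (K₂ * (η + D j)) := fun j => by
    refine (hyd j).trans (mul_le_mul_of_nonneg_left ?_ (Δ.h_pos j).le)
    have h1 := mul_le_mul_of_nonneg_left (hyK j.castSucc) hL.le
    have h2 : 0 ≤ L * K₁ * D j := by have := hD0 j; positivity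
    have h3 : 0 ≤ (1 + L) * η := by positivity
    rw [hK₂]
    nlinarith
  have hxy : ∀ j, x j = z.x.toFun (Δ.t j) + y j := fun j => by simp [hy]
  have hbi : ∀ j i, (z.b.toFun (Δ.t j) + pairing (z.a.toFun (Δ.t j)) (y j)) i =
      z.b.toFun (Δ.t j) i + inner ℝ (z.a.toFun (Δ.t j) i) (y j) := fun j i => by
    rw [PiLp.add_apply, pairing_apply]
  -- Adding `⟨aᵢ, y j⟩` to `bᵢ` translates the polyhedron by `y j`, so `p j` is a normal at `x j`
  -- too.
  refine ⟨⟨x, fun j => z.a.toFun (Δ.t j),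
    fun j => z.b.toFun (Δ.t j) + pairing (z.a.toFun (Δ.t j)) (y j), u⟩, fun j => ?_, ?_, ?_,
    fun j hj => ?_, huU, fun j => rfl, fun j τ hτ C' hC' => ?_⟩
  · refine ⟨p j - P.g (x j.castSucc) (u j), ⟨p j, ?_, rfl⟩, ?_⟩
    · simp only [DiscreteQuad.pos]
      rw [hxy]
      exact normalCone_translate (hbi j.castSucc) (hp j)
    · simp only [hxs, smul_add, smul_sub, smul_neg]
      abel
  · simp only
    rw [hxy]
    exact polyhedron_translate (hbi _) (hz.mixed _ (Δ.t_mem _))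
  · have : y 0 = 0 := by simp [hy, hx0, Δ.t_zero]
    have hp0 : pairing (z.a.toFun 0) (0 : E n) = 0 := by ext i; simp [pairing_apply]
    simp [DiscreteQuad.pos, Quad.pos, Δ.t_zero, hx0, this, hp0]
  · refine hu0' j ?_
    rw [show j.castSucc = 0 from Fin.ext hj, Δ.t_zero]
  · have hDj := hD0 j
    set e := η + D j with he
    have hηe : η ≤ e := by linarith
    have hDe : D j ≤ e := by linarith
    have he0 : 0 ≤ e := by linarith
    have hC'' : C' = e + K₂ * e + K₁ * e + B * e + A₀ * K₁ * e + A₀ * K₂ * e + B * K₁ * e := by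
      rw [hC']; ring
    have q₁ : 0 ≤ K₁ * e := by positivity
    have q₂ : 0 ≤ K₂ * e := by positivity
    have q₃ : 0 ≤ B * e := by positivity
    have q₄ : 0 ≤ A₀ * K₁ * e := by positivity
    have q₅ : 0 ≤ A₀ * K₂ * e := by positivity
    have q₆ : 0 ≤ B * K₁ * e := by positivity
    have hsub : Icc (Δ.t j.castSucc) τ ⊆ Icc 0 P.T :=
      (Icc_subset_Icc_right hτ.2).trans (Δ.Icc_subset j)
    have hτη : B * (τ - Δ.t j.castSucc) ≤ B * e :=
      mul_le_mul_of_nonneg_left (((sub_le_sub_right hτ.2 _).trans (hΔ j)).trans hηe) hB0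
    have hyj : ‖y j.castSucc‖ ≤ K₁ * e :=
      (hyK _).trans (mul_le_mul_of_nonneg_left hηe hK₁0)
    have hpair : ‖pairing (z.a.toFun (Δ.t j.castSucc)) (y j.castSucc)‖ ≤ A₀ * K₁ * e := by
      refine (norm_pairing_le _ _).trans ?_
      rw [mul_assoc]
      exact mul_le_mul (hA₀ _ (Δ.t_mem _)) hyj (norm_nonneg _) hA₀0
    have hvelx : ‖(-p j + P.g (x j.castSucc) (u j)) - z.x.vel τ‖ ≤ K₂ * e := by
      have h1 := (hbound j τ hτ).2
      have h2 : -p j + P.g (x j.castSucc) (u j) - z.x.vel τ =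
        (-p j + P.g (z.x.toFun (Δ.t j.castSucc)) (u j) - z.x.vel τ) +
          (P.g (x j.castSucc) (u j) - P.g (z.x.toFun (Δ.t j.castSucc)) (u j)) := by abel
      rw [h2]
      refine (norm_add_le _ _).trans ?_
      have h3 := (hvelg j).trans (mul_le_mul_of_nonneg_left hyj hL.le)
      have h4 : (1 + L) * D j ≤ (1 + L) * e := mul_le_mul_of_nonneg_left hDe (by linarith)
      change _ ≤ (1 + L) * D j at h1
      rw [hK₂]
      nlinarith
    have hh := Δ.h_pos j
    have hlt := Δ.strictMono (Fin.castSucc_lt_succ (i := j))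
    refine ⟨⟨?_, ?_, ?_, ?_⟩, ?_, ?_, ?_⟩
    · simp only
      rw [hxy, show z.x.toFun (Δ.t j.castSucc) + y j.castSucc - z.x.toFun τ =
        y j.castSucc - (z.x.toFun τ - z.x.toFun (Δ.t j.castSucc)) by abel]
      refine (norm_sub_le _ _).trans ?_
      linarith [z.x.norm_sub_le hBx hτ.1 hsub]
    · simp only
      rw [norm_sub_rev]
      linarith [z.a.norm_sub_le hBa hτ.1 hsub]
    · simp only
      rw [show z.b.toFun (Δ.t j.castSucc) +
        pairing (z.a.toFun (Δ.t j.castSucc)) (y j.castSucc) - z.b.toFun τ =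
        pairing (z.a.toFun (Δ.t j.castSucc)) (y j.castSucc) -
          (z.b.toFun τ - z.b.toFun (Δ.t j.castSucc)) by abel]
      refine (norm_sub_le _ _).trans ?_
      linarith [z.b.norm_sub_le hBb hτ.1 hsub]
    · have := (hbound j τ hτ).1
      change _ ≤ D j at this
      linarith
    · simp only [DiscreteQuad.vel, DiscreteQuad.pos, Prod.smul_fst, Prod.fst_sub]
      rw [hxs, add_sub_cancel_left, inv_smul_smul₀ hh.ne']
      linarith
    · simp only [DiscreteQuad.vel, DiscreteQuad.pos, Prod.smul_fst, Prod.fst_sub, Prod.smul_snd,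
        Prod.snd_sub]
      have := norm_inv_smul_sub_le hh
        (z.a.norm_slope_sub_vel_le hGa hlt (Δ.Icc_subset j) hτ)
      change _ ≤ D j at this
      linarith
    · simp only [DiscreteQuad.vel, DiscreteQuad.pos, Prod.smul_snd, Prod.snd_sub]
      have h1 := norm_inv_smul_sub_le hh
        (z.b.norm_slope_sub_vel_le hGb hlt (Δ.Icc_subset j) hτ)
      change _ ≤ D j at h1
      -- Smallness of `y` alone would not survive division by the step; the bound `hydK` on its
      -- increments and the Lipschitz bound on `a` do.
      have h2 : ‖(Δ.h j)⁻¹ • (pairing (z.a.toFun (Δ.t j.succ)) (y j.succ) -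
          pairing (z.a.toFun (Δ.t j.castSucc)) (y j.castSucc))‖ ≤
          A₀ * K₂ * e + B * K₁ * e := by
        rw [norm_smul, norm_inv, Real.norm_of_nonneg hh.le, inv_mul_le_iff₀ hh, pairing_sub]
        refine (norm_add_le _ _).trans ?_
        have e1 := (norm_pairing_le (z.a.toFun (Δ.t j.succ)) (y j.succ - y j.castSucc)).trans
          (mul_le_mul (hA₀ _ (Δ.t_mem _)) (hydK j) (norm_nonneg _) hA₀0)
        have e2 := (norm_pairing_le (z.a.toFun (Δ.t j.succ) - z.a.toFun (Δ.t j.castSucc))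
          (y j.castSucc)).trans (mul_le_mul (z.a.norm_sub_le hBa (Δ.castSucc_le_succ j)
            (Δ.Icc_subset j)) hyj (norm_nonneg _) (mul_nonneg hB0 hh.le))
        change _ ≤ B * Δ.h j * _ at e2
        calc _ ≤ _ := add_le_add e1 e2
          _ = _ := by ring
      have h3 : (Δ.h j)⁻¹ • (z.b.toFun (Δ.t j.succ) +
          pairing (z.a.toFun (Δ.t j.succ)) (y j.succ) - (z.b.toFun (Δ.t j.castSucc) +
          pairing (z.a.toFun (Δ.t j.castSucc)) (y j.castSucc))) - z.b.vel τ =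
          ((Δ.h j)⁻¹ • (z.b.toFun (Δ.t j.succ) - z.b.toFun (Δ.t j.castSucc)) - z.b.vel τ) +
          (Δ.h j)⁻¹ • (pairing (z.a.toFun (Δ.t j.succ)) (y j.succ) -
            pairing (z.a.toFun (Δ.t j.castSucc)) (y j.castSucc)) := by
        simp only [smul_add, smul_sub]
        abel
      rw [h3]
      refine (norm_add_le _ _).trans ?_
      change ‖(Δ.h j)⁻¹ • _ - _‖ ≤ D j at h1
      linarith

/-- The increments `D j` need not be small, but `D j ^ 2 * h j ≤ (G T - G 0) * D j * η`, and the `D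
j` sum to `G T - G 0`. With `η ^ 2 ≤ η` for the other term, the total is linear in `η`. -/
lemma sum_integral_le {T : ℝ} (Δ : Mesh T) {G : ℝ → ℝ} {η K : ℝ} (hη : 0 ≤ η) (hη1 : η ≤ 1)
    (hK : 0 ≤ K) (hΔ : ∀ j, Δ.h j ≤ η)
    (hG : ∀ j : Fin Δ.ν, 0 ≤ G (Δ.t j.succ) - G (Δ.t j.castSucc))
    {F : Fin Δ.ν → ℝ → ℝ} (hF0 : ∀ j t, 0 ≤ F j t)
    (hF : ∀ j, ∀ t ∈ Icc (Δ.t j.castSucc) (Δ.t j.succ),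
      F j t ≤ K * (η + (G (Δ.t j.succ) - G (Δ.t j.castSucc))) ^ 2) :
    ∑ j, ∫ t in (Δ.t j.castSucc)..(Δ.t j.succ), F j t ≤
      2 * K * (T + (G T - G 0) ^ 2) * η := by
  have hsum := Δ.sum_sub G
  have hT := Δ.sum_h
  set D : Fin Δ.ν → ℝ := fun j => G (Δ.t j.succ) - G (Δ.t j.castSucc) with hD
  have hDle : ∀ j, D j ≤ G T - G 0 := fun j => by
    rw [← hsum]
    exact Finset.single_le_sum (f := D) (fun i _ => hG i) (Finset.mem_univ j)
  have hterm : ∀ j, ∫ t in (Δ.t j.castSucc)..(Δ.t j.succ), F j t ≤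
      2 * K * η * Δ.h j + 2 * K * η * (G T - G 0) * D j := fun j => by
    have h1 := intervalIntegral.norm_integral_le_of_norm_le_const (a := Δ.t j.castSucc)
      (b := Δ.t j.succ) (f := F j) (C := K * (η + D j) ^ 2) (fun τ hτ => by
        rw [uIoc_of_le (Δ.castSucc_le_succ j)] at hτ
        rw [Real.norm_of_nonneg (hF0 j τ)]
        exact hF j τ (Ioc_subset_Icc_self hτ))
    rw [abs_of_nonneg (sub_nonneg.2 (Δ.castSucc_le_succ j))] at h1
    refine (Real.le_norm_self _).trans (h1.trans ?_)
    change K * (η + D j) ^ 2 * Δ.h j ≤ _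
    have hh := (Δ.h_pos j).le
    have hDj : 0 ≤ D j := hG j
    have h2 : (η + D j) ^ 2 ≤ 2 * η ^ 2 + 2 * D j ^ 2 := by nlinarith [sq_nonneg (η - D j)]
    have h3 : η ^ 2 * Δ.h j ≤ η * Δ.h j :=
      mul_le_mul_of_nonneg_right (by nlinarith) hh
    have h4 : D j ^ 2 * Δ.h j ≤ η * ((G T - G 0) * D j) := by
      have := hDle j
      calc D j ^ 2 * Δ.h j ≤ ((G T - G 0) * D j) * η :=
            mul_le_mul (by nlinarith) (hΔ j) hh (mul_nonneg (hDj.trans this) hDj)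
        _ = _ := mul_comm _ _
    calc K * (η + D j) ^ 2 * Δ.h j = K * ((η + D j) ^ 2 * Δ.h j) := by ring
      _ ≤ K * ((2 * η ^ 2 + 2 * D j ^ 2) * Δ.h j) :=
        mul_le_mul_of_nonneg_left (mul_le_mul_of_nonneg_right h2 hh) hK
      _ ≤ K * (2 * (η * Δ.h j) + 2 * (η * ((G T - G 0) * D j))) :=
        mul_le_mul_of_nonneg_left (by nlinarith) hK
      _ = _ := by ring
  calc _ ≤ _ := Finset.sum_le_sum fun j _ => hterm j
    _ = _ := by
      rw [Finset.sum_add_distrib, ← Finset.mul_sum, ← Finset.mul_sum, hT, hsum]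
      ring

/-- The discrete problems on fine meshes have feasible points. -/
lemma exists_discreteFeasible {P : Data n m d} {z : Quad P} (hz : z.Feasible)
    (hU : IsClosed P.U) (hg : PerturbationRegular P) (hS : UniformSlater z) (hBV : BVQuad z)
    (hu0 : z.u 0 ∈ P.U) {ε : ℝ} (hε : 0 < ε) :
    ∃ η > 0, ∀ Δ : Mesh P.T, (∀ j, Δ.h j ≤ η) → ∀ δ > 0, ∃ w, DiscreteFeasible z ε δ Δ w := by
  obtain ⟨G, hG⟩ := hBV.exists_monotone
  obtain ⟨C, hC, hex⟩ := exists_discrete_approximation hz hU hg hS hG hu0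
  -- The factor `4` counts the squared deviations of `x`, `a`, `b`, `u`; the velocity constraint has
  -- only three. Dividing by `Q + 1` below avoids a zero denominator.
  set Q := 2 * (4 * C ^ 2) * (P.T + (G P.T - G 0) ^ 2) with hQ
  have hT := P.T_pos
  have hQ0 : 0 ≤ Q := by positivity
  set η := min 1 (ε / (2 * (Q + 1))) with hηdef
  have hη : 0 < η := lt_min one_pos (by positivity)
  have hQη : Q * η ≤ ε / 2 := by
    calc Q * η ≤ (Q + 1) * (ε / (2 * (Q + 1))) :=
          mul_le_mul (by linarith) (min_le_right _ _) hη.le (by linarith)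
      _ = ε / 2 := by field_simp
  refine ⟨η, hη, fun Δ hΔ δ hδ => ?_⟩
  obtain ⟨w, hdyn, hterm, h0, hu, huU, ha, hbd⟩ := hex Δ η hη.le hΔ
  have hGj : ∀ j : Fin Δ.ν, 0 ≤ G (Δ.t j.succ) - G (Δ.t j.castSucc) := fun j =>
    (norm_nonneg _).trans (hG _ (Δ.t_mem _) _ (Δ.t_mem _) (Δ.castSucc_le_succ j)).1
  have hsq : ∀ {V : Type} [NormedAddCommGroup V] (v : V) (D : ℝ), ‖v‖ ≤ D → ‖v‖ ^ 2 ≤ D ^ 2 :=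
    fun v D h => pow_le_pow_left₀ (norm_nonneg _) h 2
  have hxe : w.x 0 = z.x.toFun 0 := congrArg Prod.fst h0
  have hae : w.a 0 = z.a.toFun 0 := congrArg (fun q => q.2.1) h0
  have hbe : w.b 0 = z.b.toFun 0 := congrArg (fun q => q.2.2) h0
  obtain ⟨i1, i2, i3⟩ := hz.initial
  refine ⟨w, hdyn, hterm, hxe.trans i1, ?_, hae.trans i2, hbe.trans i3, hu, ?_, ?_, huU, ?_⟩
  · rw [← i1, ← i2, ← i3]
    exact hz.mixed 0 ⟨le_rfl, hT.le⟩
  · refine (sum_integral_le Δ hη.le (min_le_left _ _) (by positivity : 0 ≤ 4 * C ^ 2) hΔ hGj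
      (fun j t => ?_) (fun j t ht => ?_)).trans hQη
    · simp only [sqNorm]; positivity
    · obtain ⟨⟨b1, b2, b3, b4⟩, -⟩ := hbd j t ht _ rfl
      simp only [sqNorm, DiscreteQuad.pos, Quad.pos, Prod.fst_sub, Prod.snd_sub]
      linarith [hsq _ _ b1, hsq _ _ b2, hsq _ _ b3, hsq _ _ b4]
  · refine (sum_integral_le Δ hη.le (min_le_left _ _) (by positivity : 0 ≤ 4 * C ^ 2) hΔ hGj
      (fun j t => ?_) (fun j t ht => ?_)).trans hQη
    · simp only [sqNorm]; positivity
    · obtain ⟨-, b1, b2, b3⟩ := hbd j t ht _ rfl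
      simp only [sqNorm, Quad.vel, Prod.fst_sub, Prod.snd_sub]
      have := sq_nonneg (C * (η + (G (Δ.t j.succ) - G (Δ.t j.castSucc))))
      linarith [hsq _ _ b1, hsq _ _ b2, hsq _ _ b3]
  · intro j i
    rw [ha, hz.unit _ (Δ.t_mem j) i]
    constructor <;> linarith

/-! ### Quadratic deviations -/

section Quadratic

variable {T : ℝ} {V : Type} [NormedAddCommGroup V] {f : ℝ → V}

lemma intervalIntegrable_norm_sub_sq (hf : MemLp f 2 (volume.restrict (Icc 0 T))) {s t : ℝ}
    (hst : s ≤ t) (hsub : Icc s t ⊆ Icc 0 T) (v : V) :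
    IntervalIntegrable (fun τ => ‖v - f τ‖ ^ 2) volume s t := by
  rw [intervalIntegrable_iff_integrableOn_Ioc_of_le hst]
  exact (((memLp_const v).sub (memLp_of_subset hf hsub)).norm).integrable_sq

/-- Expanding the square gives a quadratic polynomial in `v`, whose coefficients are finite because
`f` is square integrable. -/
lemma continuous_integral_norm_sub_sq [InnerProductSpace ℝ V] [CompleteSpace V]
    (hf : MemLp f 2 (volume.restrict (Icc 0 T))) {s t : ℝ}
    (hst : s ≤ t) (hsub : Icc s t ⊆ Icc 0 T) :
    Continuous fun v : V => ∫ τ in s..t, ‖v - f τ‖ ^ 2 := by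
  have hL := memLp_of_subset hf hsub
  have hi : Integrable f (volume.restrict (Ioc s t)) := hL.integrable (by norm_num)
  have : (fun v : V => ∫ τ in s..t, ‖v - f τ‖ ^ 2) = fun v =>
      (t - s) * ‖v‖ ^ 2 - 2 * inner ℝ v (∫ τ in Ioc s t, f τ) + ∫ τ in Ioc s t, ‖f τ‖ ^ 2 := by
    ext v
    rw [intervalIntegral.integral_of_le hst]
    simp_rw [norm_sub_sq_real]
    have h₁ : Integrable (fun τ => ‖v‖ ^ 2 - 2 * inner ℝ v (f τ))
        (volume.restrict (Ioc s t)) :=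
      (integrable_const _).sub ((hi.const_inner v).const_mul 2)
    rw [integral_add h₁ hL.norm.integrable_sq, integral_sub (integrable_const _) ((hi.const_inner v).const_mul 2),
      integral_const_mul, integral_inner hi]
    simp [hst]
  rw [this]
  fun_prop

end Quadratic

/-- In place of Cauchy–Schwarz, the pointwise bound `q ≤ r / (2 * T) + T / (2 * r) * q ^ 2` is
integrated over `[0, T]`. The two terms contribute at most `r / 2` and `r / 4`. -/
lemma W12.norm_sub_lt_of_velocity_close {T : ℝ} (hT : 0 < T) {V : Type} [NormedAddCommGroup V]
    [NormedSpace ℝ V] [CompleteSpace V] (f : W12 T V) (Δ : Mesh T) (w : Fin (Δ.ν + 1) → V)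
    (h0 : w 0 = f.toFun 0) {ε r : ℝ} (hr : 0 < r) (hε : ε ≤ r ^ 2 / T)
    (hclose : ∑ j : Fin Δ.ν, ∫ t in (Δ.t j.castSucc)..(Δ.t j.succ),
      ‖(Δ.h j)⁻¹ • (w j.succ - w j.castSucc) - f.vel t‖ ^ 2 ≤ ε / 2) (j : Fin (Δ.ν + 1)) :
    ‖w j - f.toFun (Δ.t j)‖ < r := by
  set p : Fin Δ.ν → V := fun j => (Δ.h j)⁻¹ • (w j.succ - w j.castSucc) with hp
  set I : Fin Δ.ν → ℝ := fun j =>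
    ∫ t in (Δ.t j.castSucc)..(Δ.t j.succ), ‖p j - f.vel t‖ ^ 2 with hI
  have hI0 : ∀ j, 0 ≤ I j := fun j =>
    intervalIntegral.integral_nonneg (Δ.castSucc_le_succ j) fun t _ => by positivity
  have hstep : ∀ j : Fin Δ.ν, ‖(w j.succ - f.toFun (Δ.t j.succ)) -
      (w j.castSucc - f.toFun (Δ.t j.castSucc))‖ ≤ r / (2 * T) * Δ.h j + T / (2 * r) * I j := by
    intro j
    have hle := Δ.castSucc_le_succ j
    have hvi := intervalIntegrable_of_memLp f.memLp_vel hle (Δ.Icc_subset j)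
    have heq : (w j.succ - f.toFun (Δ.t j.succ)) - (w j.castSucc - f.toFun (Δ.t j.castSucc)) =
        ∫ t in (Δ.t j.castSucc)..(Δ.t j.succ), (p j - f.vel t) := by
      rw [intervalIntegral.integral_sub intervalIntegrable_const hvi,
        intervalIntegral.integral_const, ← f.sub_eq_integral (Δ.t_mem _) (Δ.t_mem _) hle]
      change _ = Δ.h j • _ - _
      rw [hp, smul_inv_smul₀ (Δ.h_pos j).ne']
      abel
    have hsq := intervalIntegrable_norm_sub_sq f.memLp_vel hle (Δ.Icc_subset j) (p j)
    rw [heq]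
    refine (intervalIntegral.norm_integral_le_integral_norm hle).trans ?_
    have hint : ∫ t in (Δ.t j.castSucc)..(Δ.t j.succ),
        (r / (2 * T) + T / (2 * r) * ‖p j - f.vel t‖ ^ 2) =
        r / (2 * T) * Δ.h j + T / (2 * r) * I j := by
      rw [intervalIntegral.integral_add intervalIntegrable_const (hsq.const_mul _),
        intervalIntegral.integral_const, intervalIntegral.integral_const_mul, smul_eq_mul,
        mul_comm]
      rfl
    rw [← hint]
    refine intervalIntegral.integral_mono_on hle (intervalIntegrable_const.sub hvi).norm
      (intervalIntegrable_const.add (hsq.const_mul _)) fun t _ => ?_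
    set q := ‖p j - f.vel t‖
    have : r / (2 * T) + T / (2 * r) * q ^ 2 - q = T / (2 * r) * (q - r / T) ^ 2 := by
      field_simp
      ring
    have h2 : 0 ≤ T / (2 * r) * (q - r / T) ^ 2 := by positivity
    linarith
  -- With Gronwall constant `0` this is just the summation of the increments.
  have hgr := discrete_gronwall (fun j => ‖w j - f.toFun (Δ.t j)‖) Δ.h
    (fun j => r / (2 * T) * Δ.h j + T / (2 * r) * I j) 0 le_rfl (fun j => (Δ.h_pos j).le)
    (fun j => by have := (Δ.h_pos j).le; have := hI0 j; positivity)
    (by simp [h0, Δ.t_zero]) (fun j => norm_nonneg _) (fun j => by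
      have := norm_add_le (w j.castSucc - f.toFun (Δ.t j.castSucc))
        ((w j.succ - f.toFun (Δ.t j.succ)) - (w j.castSucc - f.toFun (Δ.t j.castSucc)))
      rw [add_sub_cancel] at this
      linarith [hstep j]) j
  rw [zero_mul, Real.exp_zero, one_mul, Finset.sum_add_distrib, ← Finset.mul_sum,
    ← Finset.mul_sum, Δ.sum_h] at hgr
  have h1 : T / (2 * r) * ∑ j, I j ≤ T / (2 * r) * (r ^ 2 / T / 2) :=
    mul_le_mul_of_nonneg_left (hclose.trans (by linarith)) (by positivity)
  have h2 : T / (2 * r) * (r ^ 2 / T / 2) = r / 4 := by field_simp; norm_num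
  have h3 : r / (2 * T) * T = r / 2 := by field_simp
  linarith

lemma integral_sqNorm_sub {T : ℝ} {f₁ : ℝ → E n} {f₂ : ℝ → A n m} {f₃ : ℝ → E m}
    (h₁ : MemLp f₁ 2 (volume.restrict (Icc 0 T))) (h₂ : MemLp f₂ 2 (volume.restrict (Icc 0 T)))
    (h₃ : MemLp f₃ 2 (volume.restrict (Icc 0 T))) {s t : ℝ} (hst : s ≤ t)
    (hsub : Icc s t ⊆ Icc 0 T) (q : XAB n m) :
    IntervalIntegrable (fun τ => sqNorm (q - (f₁ τ, f₂ τ, f₃ τ))) volume s t ∧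
    ∫ τ in s..t, sqNorm (q - (f₁ τ, f₂ τ, f₃ τ)) = (∫ τ in s..t, ‖q.1 - f₁ τ‖ ^ 2) +
      (∫ τ in s..t, ‖q.2.1 - f₂ τ‖ ^ 2) + ∫ τ in s..t, ‖q.2.2 - f₃ τ‖ ^ 2 := by
  have i₁ := intervalIntegrable_norm_sub_sq h₁ hst hsub q.1
  have i₂ := intervalIntegrable_norm_sub_sq h₂ hst hsub q.2.1
  have i₃ := intervalIntegrable_norm_sub_sq h₃ hst hsub q.2.2
  refine ⟨(i₁.add i₂).add i₃, ?_⟩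
  rw [← intervalIntegral.integral_add i₁ i₂, ← intervalIntegral.integral_add (i₁.add i₂) i₃]
  rfl

lemma continuous_integral_sqNorm_sub {T : ℝ} {f₁ : ℝ → E n} {f₂ : ℝ → A n m} {f₃ : ℝ → E m}
    (h₁ : MemLp f₁ 2 (volume.restrict (Icc 0 T))) (h₂ : MemLp f₂ 2 (volume.restrict (Icc 0 T)))
    (h₃ : MemLp f₃ 2 (volume.restrict (Icc 0 T))) {s t : ℝ} (hst : s ≤ t)
    (hsub : Icc s t ⊆ Icc 0 T) :
    Continuous fun q : XAB n m => ∫ τ in s..t, sqNorm (q - (f₁ τ, f₂ τ, f₃ τ)) := by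
  simp_rw [fun q => (integral_sqNorm_sub h₁ h₂ h₃ hst hsub q).2]
  have c₁ := continuous_integral_norm_sub_sq h₁ hst hsub
  have c₂ := continuous_integral_norm_sub_sq h₂ hst hsub
  have c₃ := continuous_integral_norm_sub_sq h₃ hst hsub
  exact ((c₁.comp continuous_fst).add (c₂.comp (continuous_fst.comp continuous_snd))).add
    (c₃.comp (continuous_snd.comp continuous_snd))

lemma continuous_integral_sqNorm_add {T : ℝ} {f₁ : ℝ → E n} {f₂ : ℝ → A n m} {f₃ : ℝ → E m}
    {g : ℝ → E d}
    (h₁ : MemLp f₁ 2 (volume.restrict (Icc 0 T))) (h₂ : MemLp f₂ 2 (volume.restrict (Icc 0 T)))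
    (h₃ : MemLp f₃ 2 (volume.restrict (Icc 0 T))) (hg : MemLp g 2 (volume.restrict (Icc 0 T)))
    {s t : ℝ} (hst : s ≤ t) (hsub : Icc s t ⊆ Icc 0 T) :
    Continuous fun q : XAB n m × E d =>
      ∫ τ in s..t, (sqNorm (q.1 - (f₁ τ, f₂ τ, f₃ τ)) + ‖q.2 - g τ‖ ^ 2) := by
  simp_rw [fun q : XAB n m × E d => intervalIntegral.integral_add
    (integral_sqNorm_sub h₁ h₂ h₃ hst hsub q.1).1
    (intervalIntegrable_norm_sub_sq hg hst hsub q.2)]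
  exact ((continuous_integral_sqNorm_sub h₁ h₂ h₃ hst hsub).comp continuous_fst).add
    ((continuous_integral_norm_sub_sq hg hst hsub).comp continuous_snd)

/-- Points that satisfy the constraints on the velocities stay near the trajectory of `z`. -/
lemma Quad.Initial.near {P : Data n m d} {z : Quad P} (hz : z.Initial) {ε r : ℝ}
    (hr : 0 < r) (hε : ε ≤ r ^ 2 / P.T) {Δ : Mesh P.T} {w : DiscreteQuad n m d Δ.ν}
    (hx : w.x 0 = P.x₀) (ha : w.a 0 = P.a₀) (hb : w.b 0 = P.b₀)
    (hsum : ∑ j : Fin Δ.ν, ∫ t in (Δ.t j.castSucc)..(Δ.t j.succ),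
      sqNorm (w.vel Δ j - z.vel t) ≤ ε / 2) (j : Fin (Δ.ν + 1)) :
    ‖w.x j - z.x.toFun (Δ.t j)‖ < r ∧ ‖w.a j - z.a.toFun (Δ.t j)‖ < r ∧
      ‖w.b j - z.b.toFun (Δ.t j)‖ < r := by
  obtain ⟨i₁, i₂, i₃⟩ := hz
  simp_rw [Quad.vel, fun j : Fin Δ.ν => (integral_sqNorm_sub z.x.memLp_vel z.a.memLp_vel
    z.b.memLp_vel (Δ.castSucc_le_succ j) (Δ.Icc_subset j) (w.vel Δ j)).2,
    Finset.sum_add_distrib] at hsum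
  have nn : ∀ {V : Type} [NormedAddCommGroup V] (F : Fin Δ.ν → ℝ → V),
      0 ≤ ∑ j : Fin Δ.ν, ∫ t in (Δ.t j.castSucc)..(Δ.t j.succ), ‖F j t‖ ^ 2 := fun F =>
    Finset.sum_nonneg fun j _ => intervalIntegral.integral_nonneg (Δ.castSucc_le_succ j)
      fun t _ => by positivity
  have n₁ := nn fun j t => (w.vel Δ j).1 - z.x.vel t
  have n₂ := nn fun j t => (w.vel Δ j).2.1 - z.a.vel t
  have n₃ := nn fun j t => (w.vel Δ j).2.2 - z.b.vel t
  refine ⟨?_, ?_, ?_⟩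
  · refine z.x.norm_sub_lt_of_velocity_close P.T_pos Δ w.x (hx.trans i₁.symm) hr hε ?_ j
    change ∑ j : Fin Δ.ν, ∫ t in (Δ.t j.castSucc)..(Δ.t j.succ),
      ‖(w.vel Δ j).1 - z.x.vel t‖ ^ 2 ≤ _
    linarith
  · refine z.a.norm_sub_lt_of_velocity_close P.T_pos Δ w.a (ha.trans i₂.symm) hr hε ?_ j
    change ∑ j : Fin Δ.ν, ∫ t in (Δ.t j.castSucc)..(Δ.t j.succ),
      ‖(w.vel Δ j).2.1 - z.a.vel t‖ ^ 2 ≤ _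
    linarith
  · refine z.b.norm_sub_lt_of_velocity_close P.T_pos Δ w.b (hb.trans i₃.symm) hr hε ?_ j
    change ∑ j : Fin Δ.ν, ∫ t in (Δ.t j.castSucc)..(Δ.t j.succ),
      ‖(w.vel Δ j).2.2 - z.b.vel t‖ ^ 2 ≤ _
    linarith

/-! ### Lower semicontinuity of extended-real sums -/

section EReal

variable {X : Type*} [TopologicalSpace X] {s : Set X}

/-- Addition of extended reals is discontinuous only where `⊤` meets `⊥`; costs that avoid `⊥` never
get there. -/
lemma lowerSemicontinuousOn_add_of_ne_bot {f g : X → EReal} (hf : LowerSemicontinuousOn f s)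
    (hg : LowerSemicontinuousOn g s) (hf' : ∀ x, f x ≠ ⊥) (hg' : ∀ x, g x ≠ ⊥) :
    LowerSemicontinuousOn (fun x => f x + g x) s :=
  hf.add' hg fun x _ => EReal.continuousAt_add (.inr (hg' x)) (.inl (hf' x))

lemma ereal_sum_ne_bot {ι : Type*} (t : Finset ι) {f : ι → EReal} (hf : ∀ i, f i ≠ ⊥) :
    ∑ i ∈ t, f i ≠ ⊥ := by
  classical
  induction t using Finset.induction_on with
  | empty => simp
  | insert i t hi ih =>
    rw [Finset.sum_insert hi]
    exact EReal.add_ne_bot_iff.2 ⟨hf i, ih⟩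

lemma lowerSemicontinuousOn_sum_of_ne_bot {ι : Type*} (t : Finset ι) {f : ι → X → EReal}
    (hf : ∀ i, LowerSemicontinuousOn (f i) s) (hf' : ∀ i x, f i x ≠ ⊥) :
    LowerSemicontinuousOn (fun x => ∑ i ∈ t, f i x) s := by
  classical
  induction t using Finset.induction_on with
  | empty => simpa using lowerSemicontinuousOn_const
  | insert i t hi ih =>
    simp_rw [Finset.sum_insert hi]
    exact lowerSemicontinuousOn_add_of_ne_bot (hf i) ih (hf' i)
      fun x => ereal_sum_ne_bot t fun i => hf' i x

lemma coe_mul_ne_bot {h : ℝ} (hh : 0 < h) {x : EReal} (hx : x ≠ ⊥) : (h : EReal) * x ≠ ⊥ := by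
  rw [EReal.mul_ne_bot]
  refine ⟨.inl (EReal.coe_ne_bot h), .inr hx, .inl (EReal.coe_ne_top h), .inl ?_⟩
  exact_mod_cast hh.le

lemma lowerSemicontinuousOn_coe_mul {h : ℝ} (hh : 0 < h) {f : X → EReal}
    (hf : LowerSemicontinuousOn f s) : LowerSemicontinuousOn (fun x => (h : EReal) * f x) s := by
  have hc : Continuous fun y : EReal => (h : EReal) * y :=
    continuous_iff_continuousAt.2 fun y => EReal.Tendsto.const_mul tendsto_id
      (.inl (EReal.coe_ne_bot h)) (.inl (EReal.coe_ne_top h))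
  have hm : Monotone fun y : EReal => (h : EReal) * y := fun y y' hy =>
    mul_le_mul_of_nonneg_left hy (by exact_mod_cast hh.le)
  exact hc.comp_lowerSemicontinuousOn hf hm

end EReal

/-! ### Compactness of the feasible set -/

/-- Discrete quadruples as points of a product of Euclidean spaces. -/
abbrev DiscreteSpace (n m d ν : ℕ) : Type :=
  (Fin (ν + 1) → E n) × (Fin (ν + 1) → A n m) × (Fin (ν + 1) → E m) × (Fin ν → E d)

/-- The discrete quadruple with given components. -/
def DiscreteQuad.ofProd {ν : ℕ} (q : DiscreteSpace n m d ν) : DiscreteQuad n m d ν :=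
  ⟨q.1, q.2.1, q.2.2.1, q.2.2.2⟩

lemma continuous_ofProd_pos {ν : ℕ} (j : Fin (ν + 1)) :
    Continuous fun q : DiscreteSpace n m d ν => (DiscreteQuad.ofProd q).pos j := by
  simp only [DiscreteQuad.ofProd, DiscreteQuad.pos]
  fun_prop

lemma continuous_ofProd_u {ν : ℕ} (j : Fin ν) :
    Continuous fun q : DiscreteSpace n m d ν => (DiscreteQuad.ofProd q).u j := by
  simp only [DiscreteQuad.ofProd]
  fun_prop

lemma continuous_ofProd_vel {T : ℝ} (Δ : Mesh T) (j : Fin Δ.ν) :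
    Continuous fun q : DiscreteSpace n m d Δ.ν => (DiscreteQuad.ofProd q).vel Δ j :=
  ((continuous_ofProd_pos j.succ).sub (continuous_ofProd_pos j.castSucc)).const_smul
    (Δ.h j)⁻¹

lemma continuous_integral_close {P : Data n m d} (z : Quad P) (Δ : Mesh P.T) (j : Fin Δ.ν) :
    Continuous fun q : DiscreteSpace n m d Δ.ν =>
      ∫ t in (Δ.t j.castSucc)..(Δ.t j.succ), 
        (sqNorm ((DiscreteQuad.ofProd q).pos j.castSucc - z.pos t) +
          ‖(DiscreteQuad.ofProd q).u j - z.u t‖ ^ 2) := by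
  have h : Continuous fun q : XAB n m × E d => ∫ t in (Δ.t j.castSucc)..(Δ.t j.succ),
      (sqNorm (q.1 - z.pos t) + ‖q.2 - z.u t‖ ^ 2) :=
    continuous_integral_sqNorm_add z.x.memLp z.a.memLp z.b.memLp z.memLp_u
      (Δ.castSucc_le_succ j) (Δ.Icc_subset j)
  have h' := h.comp
    ((continuous_ofProd_pos (n := n) (m := m) (d := d) j.castSucc).prodMk (continuous_ofProd_u j))
  exact h'

lemma continuous_close {P : Data n m d} (z : Quad P) (Δ : Mesh P.T) :
    Continuous fun q : DiscreteSpace n m d Δ.ν =>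
      ∑ j : Fin Δ.ν, ∫ t in (Δ.t j.castSucc)..(Δ.t j.succ), 
        (sqNorm ((DiscreteQuad.ofProd q).pos j.castSucc - z.pos t) +
          ‖(DiscreteQuad.ofProd q).u j - z.u t‖ ^ 2) :=
  continuous_finsetSum _ fun j _ => continuous_integral_close z Δ j

lemma continuous_integral_close_vel {P : Data n m d} (z : Quad P) (Δ : Mesh P.T) (j : Fin Δ.ν) :
    Continuous fun q : DiscreteSpace n m d Δ.ν =>
      ∫ t in (Δ.t j.castSucc)..(Δ.t j.succ), 
        sqNorm ((DiscreteQuad.ofProd q).vel Δ j - z.vel t) := by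
  have h := continuous_integral_sqNorm_sub z.x.memLp_vel z.a.memLp_vel z.b.memLp_vel
    (Δ.castSucc_le_succ j) (Δ.Icc_subset j)
  exact h.comp (continuous_ofProd_vel Δ j)

lemma continuous_close_vel {P : Data n m d} (z : Quad P) (Δ : Mesh P.T) :
    Continuous fun q : DiscreteSpace n m d Δ.ν =>
      ∑ j : Fin Δ.ν, ∫ t in (Δ.t j.castSucc)..(Δ.t j.succ), 
        sqNorm ((DiscreteQuad.ofProd q).vel Δ j - z.vel t) :=
  continuous_finsetSum _ fun j _ => continuous_integral_close_vel z Δ j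

lemma continuous_integral_penalty {P : Data n m d} (z : Quad P) (Δ : Mesh P.T) (j : Fin Δ.ν) :
    Continuous fun q : DiscreteSpace n m d Δ.ν =>
      ∫ t in (Δ.t j.castSucc)..(Δ.t j.succ), 
        (sqNorm ((DiscreteQuad.ofProd q).vel Δ j - z.vel t) +
          ‖(DiscreteQuad.ofProd q).u j - z.u t‖ ^ 2) := by
  have h : Continuous fun q : XAB n m × E d => ∫ t in (Δ.t j.castSucc)..(Δ.t j.succ),
      (sqNorm (q.1 - z.vel t) + ‖q.2 - z.u t‖ ^ 2) :=
    continuous_integral_sqNorm_add z.x.memLp_vel z.a.memLp_vel z.b.memLp_vel z.memLp_u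
      (Δ.castSucc_le_succ j) (Δ.Icc_subset j)
  have h' := h.comp
    ((continuous_ofProd_vel (n := n) (m := m) (d := d) Δ j).prodMk (continuous_ofProd_u j))
  exact h'

lemma continuous_penalty {P : Data n m d} (z : Quad P) (Δ : Mesh P.T) :
    Continuous fun q : DiscreteSpace n m d Δ.ν =>
      ∑ j : Fin Δ.ν, ∫ t in (Δ.t j.castSucc)..(Δ.t j.succ), 
        (sqNorm ((DiscreteQuad.ofProd q).vel Δ j - z.vel t) +
          ‖(DiscreteQuad.ofProd q).u j - z.u t‖ ^ 2) :=
  continuous_finsetSum _ fun j _ => continuous_integral_penalty z Δ j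

/-- Bounded, as nodes stay in balls around the trajectory and controls in `U`. Closed, because every
constraint is either continuous or, for the dynamics, covered by the closed graph of the normal
cone. -/
lemma isCompact_discreteFeasible {P : Data n m d} {z : Quad P} (hz : z.Initial)
    (hU : CompactControls P) (hg : PerturbationRegular P) {ε δ r : ℝ}
    (hr : 0 < r) (hε : ε ≤ r ^ 2 / P.T)
    (hS : ∀ t ∈ Icc 0 P.T, ∀ a b, ‖a - z.a.toFun t‖ < r → ‖b - z.b.toFun t‖ < r → Slater a b)
    (Δ : Mesh P.T) :
    IsCompact {q | DiscreteFeasible z ε δ Δ (DiscreteQuad.ofProd q)} := by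
  obtain ⟨⟨L, -, hgL⟩, -⟩ := hg
  refine Metric.isCompact_of_isClosed_isBounded (IsSeqClosed.isClosed fun q q' hq hlim => ?_) ?_
  · have hx : ∀ j, Tendsto (fun k => (q k).1 j) atTop (𝓝 (q'.1 j)) := fun j =>
      ((by fun_prop : Continuous fun q : DiscreteSpace n m d Δ.ν => q.1 j).tendsto _).comp hlim
    have ha : ∀ j, Tendsto (fun k => (q k).2.1 j) atTop (𝓝 (q'.2.1 j)) := fun j =>
      ((by fun_prop : Continuous fun q : DiscreteSpace n m d Δ.ν => q.2.1 j).tendsto _).comp hlim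
    have hb : ∀ j, Tendsto (fun k => (q k).2.2.1 j) atTop (𝓝 (q'.2.2.1 j)) := fun j =>
      ((by fun_prop : Continuous fun q : DiscreteSpace n m d Δ.ν => q.2.2.1 j).tendsto _).comp
        hlim
    have hu : ∀ j, Tendsto (fun k => (q k).2.2.2 j) atTop (𝓝 (q'.2.2.2 j)) := fun j =>
      ((by fun_prop : Continuous fun q : DiscreteSpace n m d Δ.ν => q.2.2.2 j).tendsto _).comp
        hlim
    have hU' : ∀ j, q'.2.2.2 j ∈ P.U := fun j =>
      hU.1.mem_of_tendsto (hu j) (Eventually.of_forall fun k => (hq k).control j)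
    have hx0 : q'.1 0 = P.x₀ :=
      tendsto_nhds_unique (hx 0) (tendsto_const_nhds.congr fun k => (hq k).initial_x.symm)
    have ha0 : q'.2.1 0 = P.a₀ :=
      tendsto_nhds_unique (ha 0) (tendsto_const_nhds.congr fun k => (hq k).initial_a.symm)
    have hb0 : q'.2.2.1 0 = P.b₀ :=
      tendsto_nhds_unique (hb 0) (tendsto_const_nhds.congr fun k => (hq k).initial_b.symm)
    have hclose := le_of_tendsto (((continuous_close z Δ).tendsto q').comp hlim)
      (Eventually.of_forall fun k => (hq k).close)
    have hclose' := le_of_tendsto (((continuous_close_vel z Δ).tendsto q').comp hlim)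
      (Eventually.of_forall fun k => (hq k).close_vel)
    -- Applied to the limit itself, which already satisfies the initial and velocity constraints;
    -- this gives the Slater condition at the limit pair `(a_j, b_j)`.
    have hnear := fun j => (hz.near (w := DiscreteQuad.ofProd q') hr hε hx0 ha0 hb0 hclose' j).2
    refine ⟨fun j => ?_, ?_, hx0, (hq 0).initial_mem, ha0, hb0, fun j hj => ?_, hclose, hclose',
      hU', fun j i => ?_⟩
    · have hgl := tendsto_perturbation hgL (hx j.castSucc) (hu j)
        (Eventually.of_forall fun k => (hq k).control j) (hU' j)
      have hh := (Δ.h_pos j).ne'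
      -- The normal in the dynamics is recovered from consecutive points and the control, so it
      -- converges with them.
      have hlimv := (((hx j.castSucc).sub (hx j.succ)).const_smul (Δ.h j)⁻¹).add hgl
      refine ⟨_, ⟨_, normalCone_mem_of_tendsto (hx j.castSucc) hlimv (ha j.castSucc)
        (hb j.castSucc) (hS _ (Δ.t_mem _) _ _ (hnear _).1 (hnear _).2)
        (Eventually.of_forall fun k => ?_), rfl⟩, ?_⟩
      · obtain ⟨v, ⟨w, hw, rfl⟩, hv⟩ := (hq k).dynamics j
        change (q k).1 j.succ = (q k).1 j.castSucc - Δ.h j • (w - P.g ((q k).1 j.castSucc)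
          ((q k).2.2.2 j)) at hv
        rw [hv, sub_sub_cancel, inv_smul_smul₀ hh, sub_add_cancel]
        exact hw
      · change q'.1 j.succ = q'.1 j.castSucc - Δ.h j • ((Δ.h j)⁻¹ • (q'.1 j.castSucc - q'.1 j.succ)
          + P.g (q'.1 j.castSucc) (q'.2.2.2 j) - P.g (q'.1 j.castSucc) (q'.2.2.2 j))
        rw [add_sub_cancel_right, smul_inv_smul₀ hh, sub_sub_cancel]
    · exact polyhedron_mem_of_tendsto (hx _) (ha _) (hb _)
        (Eventually.of_forall fun k => (hq k).terminal)
    · exact tendsto_nhds_unique (hu j)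
        (tendsto_const_nhds.congr fun k => ((hq k).initial_u j hj).symm)
    · have : Tendsto (fun k => ‖(q k).2.1 j i‖) atTop (𝓝 ‖q'.2.1 j i‖) :=
        ((by fun_prop : Continuous fun a : A n m => ‖a i‖).tendsto _).comp (ha j)
      exact ⟨ge_of_tendsto this (Eventually.of_forall fun k => ((hq k).norm_a j i).1),
        le_of_tendsto this (Eventually.of_forall fun k => ((hq k).norm_a j i).2)⟩
  · have hball : ∀ {V : Type} [NormedAddCommGroup V] (f : Fin (Δ.ν + 1) → V),
        Bornology.IsBounded (univ.pi fun j => Metric.ball (f j) r) := fun f =>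
      Bornology.IsBounded.pi fun j => Metric.isBounded_ball
    refine (((hball fun j => z.x.toFun (Δ.t j)).prod ((hball fun j => z.a.toFun (Δ.t j)).prod
      ((hball fun j => z.b.toFun (Δ.t j)).prod
        (Bornology.IsBounded.pi fun _ : Fin Δ.ν => hU.2)))).subset ?_)
    intro q hq
    have hn := hz.near hr hε hq.initial_x hq.initial_a hq.initial_b hq.close_vel
    exact ⟨fun j _ => mem_ball_iff_norm.2 (hn j).1, fun j _ => mem_ball_iff_norm.2 (hn j).2.1,
      fun j _ => mem_ball_iff_norm.2 (hn j).2.2, fun j _ => hq.control j⟩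

/-- Feasible points lie in the tube at each left node, which is where the regularity of the running
cost applies. -/
lemma lowerSemicontinuousOn_discreteJ {P : Data n m d} {z : Quad P} (hz : z.Initial)
    {ρ c ε δ r : ℝ} (hφ : LowerSemicontinuous P.φ)
    (hr : 0 < r) (hrρ : r ≤ ρ) (hε : ε ≤ r ^ 2 / P.T) (Δ : Mesh P.T)
    (hreg : ∀ j : Fin Δ.ν, RunningCostRegularAt z ρ c (Δ.t j.castSucc)) :
    LowerSemicontinuousOn (fun q => discreteJ z Δ (DiscreteQuad.ofProd q))
      {q | DiscreteFeasible z ε δ Δ (DiscreteQuad.ofProd q)} := by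
  set S := {q | DiscreteFeasible z ε δ Δ (DiscreteQuad.ofProd q)} with hSdef
  have hφ' : LowerSemicontinuousOn
      (fun q : DiscreteSpace n m d Δ.ν => P.φ ((DiscreteQuad.ofProd q).x (Fin.last Δ.ν))) S :=
    ((hφ.comp (by fun_prop :
      Continuous fun q : DiscreteSpace n m d Δ.ν => q.1 (Fin.last Δ.ν)))).lowerSemicontinuousOn S
  have hℓ : ∀ j : Fin Δ.ν, LowerSemicontinuousOn (fun q : DiscreteSpace n m d Δ.ν =>
      P.ℓ (Δ.t j.castSucc) ((DiscreteQuad.ofProd q).pos j.castSucc, (DiscreteQuad.ofProd q).u j,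
        (DiscreteQuad.ofProd q).vel Δ j)) S := fun j => by
    refine (hreg j).1.comp ((continuous_ofProd_pos j.castSucc).prodMk
      ((continuous_ofProd_u j).prodMk (continuous_ofProd_vel Δ j))).continuousOn fun q hq => ?_
    obtain ⟨h₁, h₂, h₃⟩ := hz.near hr hε hq.initial_x hq.initial_a hq.initial_b hq.close_vel
      j.castSucc
    refine ⟨?_, hq.control j⟩
    simp only [DiscreteQuad.pos, Quad.pos, dist_eq_norm]
    exact (max_lt h₁ (max_lt h₂ h₃)).trans_le hrρ
  have hpen : LowerSemicontinuousOn (fun q : DiscreteSpace n m d Δ.ν =>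
      (((1 / 2 : ℝ) * ∑ j : Fin Δ.ν, ∫ t in (Δ.t j.castSucc)..(Δ.t j.succ),
        (sqNorm ((DiscreteQuad.ofProd q).vel Δ j - z.vel t) +
          ‖(DiscreteQuad.ofProd q).u j - z.u t‖ ^ 2) : ℝ) : EReal)) S :=
    (continuous_coe_real_ereal.comp
      ((continuous_penalty z Δ).const_mul (1 / 2))).lowerSemicontinuous.lowerSemicontinuousOn S
  have hnb := fun (j : Fin Δ.ν) (q : DiscreteSpace n m d Δ.ν) =>
    coe_mul_ne_bot (Δ.h_pos j) (P.ℓ_ne_bot (Δ.t j.castSucc)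
      ((DiscreteQuad.ofProd q).pos j.castSucc, (DiscreteQuad.ofProd q).u j,
        (DiscreteQuad.ofProd q).vel Δ j))
  refine lowerSemicontinuousOn_add_of_ne_bot (lowerSemicontinuousOn_add_of_ne_bot hφ'
    (lowerSemicontinuousOn_sum_of_ne_bot _
      (fun j => lowerSemicontinuousOn_coe_mul (Δ.h_pos j) (hℓ j)) hnb)
    (fun q => P.φ_ne_bot _) fun q => ereal_sum_ne_bot _ fun j => hnb j q) hpen
    (fun q => EReal.add_ne_bot_iff.2 ⟨P.φ_ne_bot _, ereal_sum_ne_bot _ fun j => hnb j q⟩)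
    fun q => EReal.coe_ne_bot _

end SweepingControl

theorem proposition5p1 {n m d : ℕ} (P : Data n m d) (z : Quad P)
    (εbar : ℝ) (hz : z.IsRILM εbar)
    (h1 : CompactControls P) (h2 : BoundedDerivatives z) (h3 : PerturbationRegular P) (h4 : UniformSlater z)
    (ρ c : ℝ) (hρ : 0 < ρ) (h5 : CostRegular z ρ c)
    (hBV : BVQuad z) (hu0 : z.u 0 ∈ P.U) :
    ∃ ε₀ : ℝ, 0 < ε₀ ∧ ε₀ ≤ εbar ∧ ∀ ε : ℝ, 0 < ε → ε ≤ ε₀ →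
      ∀ (νtilde : ℝ) (Δ : ℕ → Mesh P.T) (δ : ℕ → ℝ),
        0 < νtilde →
        (∀ k, k ≤ (Δ k).ν) →
        (∀ k, ∀ j : Fin (Δ k).ν, (Δ k).h j ≤ νtilde / ((Δ k).ν : ℝ)) →
        (∀ k, ∀ j : Fin (Δ k).ν, RunningCostRegularAt z ρ c ((Δ k).t j.castSucc)) →
        (∀ k, 0 < δ k) →
        Tendsto δ atTop (𝓝 0) →
        ∀ᶠ k in atTop, ∃ w : DiscreteQuad n m d (Δ k).ν, DiscreteOptimal z ε (δ k) (Δ k) w := by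
  obtain ⟨r₀, hr₀, hS⟩ := h4.exists_radius
  -- Within `r₀` the Slater condition persists; within `ρ` the running cost is lower semicontinuous
  -- at the nodes.
  set r := min r₀ ρ
  have hr : 0 < r := lt_min hr₀ hρ
  have hrρ : r ≤ ρ := min_le_right _ _
  have hT := P.T_pos
  refine ⟨min εbar (r ^ 2 / P.T), lt_min hz.pos (by positivity), min_le_left _ _,
    fun ε hε hε₀ νtilde Δ δ hν hk hh hreg hδ _ => ?_⟩
  have hεr : ε ≤ r ^ 2 / P.T := hε₀.trans (min_le_right _ _)
  obtain ⟨η, hη, hex⟩ := exists_discreteFeasible hz.feasible h1.1 h3 h4 hBV hu0 hε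
  -- The threshold `η` depends on `ε` but not on the mesh, and the steps are at most `νtilde / k`
  -- because the mesh has at least `k` of them.
  have hev : ∀ᶠ k : ℕ in atTop, νtilde / (k : ℝ) < η :=
    (tendsto_const_div_atTop_nhds_zero_nat νtilde).eventually_lt_const hη
  filter_upwards [hev, eventually_gt_atTop 0] with k hkη hk0
  have hk0' : (0 : ℝ) < k := by exact_mod_cast hk0
  have hkν : (k : ℝ) ≤ (Δ k).ν := by exact_mod_cast hk k
  obtain ⟨w, hw⟩ := hex (Δ k) (fun j => ((hh k j).trans
    (div_le_div_of_nonneg_left hν.le hk0' hkν)).trans hkη.le) (δ k) (hδ k)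
  have hcompact := isCompact_discreteFeasible (δ := δ k) hz.feasible.initial h1 h3 hr hεr
    (fun t ht a b ha hb => hS t ht a b (ha.trans_le (min_le_left _ _))
      (hb.trans_le (min_le_left _ _))) (Δ k)
  obtain ⟨q, hq, hmin⟩ := (lowerSemicontinuousOn_discreteJ (δ := δ k) hz.feasible.initial h5.1 hr
    hrρ hεr (Δ k) (hreg k)).exists_isMinOn ⟨(w.x, w.a, w.b, w.u), hw⟩ hcompact
  exact ⟨_, hq, fun w' hw' =>
    isMinOn_iff.1 hmin (w'.x, w'.a, w'.b, w'.u) hw'⟩
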